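/- Let $\mathcal C$ be a symmetric monoidal abelian category with unit $I$ and symmetry $\psi$ (associativity and unit constraints are suppressed below, $A^n$ denotes $A^{\otimes n}$ with $A^0=I$, $1$ denotes identities and $(f,g)=f\otimes g$). Let $(H,m,\eta,\Delta,\varepsilon,S)$ be a Hopf algebra in $\mathcal C$ and let $(\delta,\sigma)$ be a braided modular pair in involution (MPI) for $H$: $\delta:H\to I$ is an algebra map, $\sigma:I\to H$ is a coalgebra map, $\delta\sigma=\mathrm{id}_I$, and $m(m\otimes 1)(S\sigma\otimes\widetilde S^2\otimes\sigma)=\mathrm{id}_H$, where $\widetilde S=(\delta\otimes S)\Delta$. *The cocyclic object of a triple.* For a left $H$-module coalgebra $C$ with action $\phi_C$ (a coalgebra with a left $H$-action that is a coalgebra map $H\otimes C\to C$), and an object $M$ with a right $H$-action $\phi_M:M\otimes H\to M$ and a left $H$-coaction $\rho_M:M\to H\otimes M$ making it a stable anti-Yetter–Drinfeld (SAYD) module, i.e. $\phi_M\psi_{H,M}\rho_M=1_M$ and $$\rho_M\phi_M=(m(S\otimes m)\otimes\phi_M)(\psi_{H^2,H}\otimes 1_M\otimes 1_H)(1_{H^2}\otimes\psi_{M,H}\otimes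 1_H)(1_{H^2}\otimes 1_M\otimes\psi_{H,H})(1_H\otimes\psi_{M,H}\otimes1_{H^2})(\rho_M\otimes\Delta^2),$$ put on the objects $M\otimes C^{n+1}$, $n\ge 0$, $$\delta_i=(1_M,1_{C^i},\Delta_C,1_{C^{n-i-1}})\ (0\le i<n),\qquad \delta_n=(1_M,\psi_{C,C^n})(1_M,\phi_C,1_{C^n})(\psi_{H,M},1_{C^{n+1}})(\rho_M,\Delta_C,1_{C^{n-1}})$$ as maps from degree $n-1$ to degree $n$, $\sigma_i=(1_M,1_{C^{i+1}},\varepsilon_C,1_{C^{n-i}})$ $(0\le i\le n)$ from degree $n+1$ to degree $n$, and $\tau_n=(1_M,\psi_{C,C^n})(1_M,\phi_C,1_{C^n})(\psi_{H,M},1_{C^{n+1}})(\rho_M,1_{C^{n+1}})$. The associated cocyclic object has objects $M\otimes_H C^{n+1}=\mathrm{coker}(\phi_M\otimes 1-1\otimes\phi_{C^{n+1}}:M\otimes H\otimes C^{n+1}\to M\otimes C^{n+1})$, where $\phi_{C^{n+1}}$ is the diagonal action (comultiply $H$ into $n+1$ factors and let each act on one factor $C$), and the induced maps $\widetilde\delta_i,\widetilde\sigma_i,\widetilde\tau_n$.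 **Theorem.** The coalgebra $H$ with the left action $m$ is a left $H$-module coalgebra, and ${}^{\sigma}I_\delta$, i.e. $I$ with the right action $\delta:I\otimes H=H\to I$ and the left coaction $\sigma:I\to H=H\otimes I$, is a SAYD module. For $C=H$ and $M={}^\sigma I_\delta$ the above maps descend to the objects ${}^\sigma I_\delta\otimes_H H^{n+1}$ and make them a cocyclic object in $\mathcal C$, and this cocyclic object is isomorphic to the following one (which is therefore also a cocyclic object): $C^0(H)=I$, $C^n(H)=H^n$ for $n\ge1$, with faces $\delta_i:H^{n-1}\to H^n$ $(n\ge 1)$ $$\delta_0=(\eta,1,\dots,1),\qquad \delta_i=(1,\dots,1,\underset{i\text{-th}}{\Delta},1,\dots,1)\ (1\le i\le n-1),\qquad \delta_n=(1,\dots,1,\sigma),$$ degeneracies $\sigma_i=(1,\dots,1,\underset{(i+1)\text{-th}}{\varepsilon},1,\dots,1):H^{n+1}\to H^n$ $(0\le i\le n)$, and cyclic maps $$\tau_0=\mathrm{id}_I,\qquad \tau_n=m_n\,(\Delta^{n-1}\widetilde S,\,1_{H^{n-1}},\,\sigma)\quad(n\ge1).$$ Here $\Delta^{n-1}:H\to H^{n}$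 is the iterated comultiplication, $m_1=m$, and for $n\ge2$, $m_n=(m,\dots,m)\,\mathcal F_n(\psi):H^n\otimes H^n\to H^n$ with $\mathcal F_n(\psi)=\prod_{j=1}^{n-1}(1_{H^j},\underbrace{\psi_{H,H},\dots,\psi_{H,H}}_{n-j},1_{H^j})$, the factor with $j=n-1$ being applied first (so $m_n$ is the multiplication of the tensor power algebra $H^{n}$). -/

import Mathlib

open CategoryTheory MonoidalCategory Limits
open scoped MonObj ComonObj HopfObj

universe v u

namespace BraidedHopfCyclic

noncomputable section

/-! ### Cocyclic objects -/

/-- The data underlying a cocyclic object: objects `X n`, cofaces `δ_i : X n ⟶ X (n+1)`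
(`0 ≤ i ≤ n+1`), codegeneracies `σ_i : X (n+1) ⟶ X n` (`0 ≤ i ≤ n`) and cyclic operators
`τ_n : X n ⟶ X n`. -/
structure CocyclicData (C : Type u) [Category.{v} C] where
  X : ℕ → C
  δ : ∀ n : ℕ, Fin (n + 2) → (X n ⟶ X (n + 1))
  σ : ∀ n : ℕ, Fin (n + 1) → (X (n + 1) ⟶ X n)
  τ : ∀ n : ℕ, X n ⟶ X n

/-- The axioms of a cocyclic object (the cosimplicial identities, the relations between the cyclic
operators and the cofaces and codegeneracies, and `τ_n ^ (n+1) = id`). -/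
structure CocyclicData.IsCocyclic {C : Type u} [Category.{v} C] (D : CocyclicData C) : Prop where
  δ_comp_δ : ∀ (n : ℕ) (i j : Fin (n + 2)), i ≤ j →
    D.δ n i ≫ D.δ (n + 1) j.succ = D.δ n j ≫ D.δ (n + 1) i.castSucc
  σ_comp_σ : ∀ (n : ℕ) (i j : Fin (n + 1)), i ≤ j →
    D.σ (n + 1) i.castSucc ≫ D.σ n j = D.σ (n + 1) j.succ ≫ D.σ n i
  δ_comp_σ_of_le : ∀ (n : ℕ) (i : Fin (n + 2)) (j : Fin (n + 1)), i ≤ j.castSucc →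
    D.δ (n + 1) i.castSucc ≫ D.σ (n + 1) j.succ = D.σ n j ≫ D.δ n i
  δ_comp_σ_self : ∀ (n : ℕ) (i : Fin (n + 1)), D.δ n i.castSucc ≫ D.σ n i = 𝟙 (D.X n)
  δ_comp_σ_succ : ∀ (n : ℕ) (i : Fin (n + 1)), D.δ n i.succ ≫ D.σ n i = 𝟙 (D.X n)
  δ_comp_σ_of_gt : ∀ (n : ℕ) (i : Fin (n + 2)) (j : Fin (n + 1)), j.castSucc < i →
    D.δ (n + 1) i.succ ≫ D.σ (n + 1) j.castSucc = D.σ n j ≫ D.δ n i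
  δ_succ_comp_τ : ∀ (n : ℕ) (i : Fin (n + 1)),
    D.δ n i.succ ≫ D.τ (n + 1) = D.τ n ≫ D.δ n i.castSucc
  δ_zero_comp_τ : ∀ n : ℕ, D.δ n 0 ≫ D.τ (n + 1) = D.δ n (Fin.last (n + 1))
  σ_succ_comp_τ : ∀ (n : ℕ) (i : Fin n),
    D.σ n i.succ ≫ D.τ n = D.τ (n + 1) ≫ D.σ n i.castSucc
  σ_zero_comp_τ : ∀ n : ℕ,
    D.σ n 0 ≫ D.τ n = D.τ (n + 1) ≫ D.τ (n + 1) ≫ D.σ n (Fin.last n)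
  τ_pow : ∀ n : ℕ, (show End (D.X n) from D.τ n) ^ (n + 1) = 1

/-- Isomorphisms: degreewise isomorphisms commuting with all structure maps. -/
structure CocyclicData.Iso {C : Type u} [Category.{v} C] (D E : CocyclicData C) where
  iso : ∀ n : ℕ, D.X n ≅ E.X n
  comm_δ : ∀ (n : ℕ) (i : Fin (n + 2)), D.δ n i ≫ (iso (n + 1)).hom = (iso n).hom ≫ E.δ n i
  comm_σ : ∀ (n : ℕ) (i : Fin (n + 1)), D.σ n i ≫ (iso n).hom = (iso (n + 1)).hom ≫ E.σ n i
  comm_τ : ∀ n : ℕ, D.τ n ≫ (iso n).hom = (iso n).hom ≫ E.τ n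

section Monoidal

variable {C : Type u} [Category.{v} C] [MonoidalCategory C]

/-! ### Tensor powers -/

/-- The tensor power `A^{⊗ n}`, with `A^{⊗ 0} = 𝟙_ C` and `A^{⊗ (n+1)} = A ⊗ A^{⊗ n}`. -/
def pow (A : C) : ℕ → C
  | 0 => 𝟙_ C
  | n + 1 => A ⊗ pow A n

/-- `f^{⊗ n} : A^{⊗ n} ⟶ B^{⊗ n}`. -/
def powMap {A B : C} (f : A ⟶ B) : (n : ℕ) → (pow A n ⟶ pow B n)
  | 0 => 𝟙 (𝟙_ C)
  | n + 1 => f ⊗ₘ powMap f n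

/-- The coherence isomorphism `A^{⊗ n} ⊗ A ≅ A^{⊗ (n+1)}`. -/
def powSnoc (A : C) : (n : ℕ) → (pow A n ⊗ A ≅ pow A (n + 1))
  | 0 => λ_ A ≪≫ (ρ_ A).symm
  | n + 1 => α_ A (pow A n) A ≪≫ whiskerLeftIso A (powSnoc A n)

/-- `(1, …, 1, Δ, 1, …, 1) : A^{⊗ n} ⟶ A^{⊗ (n+1)}`, the comultiplication applied to the factor
number `i` (counted from `0`). -/
def comulAt (A : C) [ComonObj A] : (n : ℕ) → Fin n → (pow A n ⟶ pow A (n + 1))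
  | 0 => fun i => i.elim0
  | n + 1 => Fin.cases (Δ[A] ▷ pow A n ≫ (α_ A A (pow A n)).hom) (fun i => A ◁ comulAt A n i)

/-- `(1, …, 1, ε, 1, …, 1) : A^{⊗ (n+1)} ⟶ A^{⊗ n}`, the counit applied to the factor
number `i` (counted from `0`). -/
def counitAt (A : C) [ComonObj A] : (n : ℕ) → Fin (n + 1) → (pow A (n + 1) ⟶ pow A n)
  | 0 => fun _ => ε[A] ▷ 𝟙_ C ≫ (λ_ (𝟙_ C)).hom
  | n + 1 => Fin.cases (ε[A] ▷ pow A (n + 1) ≫ (λ_ (pow A (n + 1))).hom)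
      (fun i => A ◁ counitAt A n i)

/-- The iterated comultiplication `Δ^n : A ⟶ A^{⊗ (n+1)}`, with `Δ^0 = id`. -/
def comulPow (A : C) [ComonObj A] : (n : ℕ) → (A ⟶ pow A (n + 1))
  | 0 => (ρ_ A).inv
  | n + 1 => Δ[A] ≫ A ◁ comulPow A n

/-- The braid `A^{⊗ n} ⊗ B^{⊗ n} ⟶ (A ⊗ B)^{⊗ n}` sending `a₁ ⊗ ⋯ ⊗ aₙ ⊗ b₁ ⊗ ⋯ ⊗ bₙ` to
`a₁ ⊗ b₁ ⊗ ⋯ ⊗ aₙ ⊗ bₙ`, in which every `b_i` is moved by the braiding `ψ_{A,B}` past all the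
`a_j` with `j > i`; for `n = 2` it is `1 ⊗ ψ_{A,B} ⊗ 1`. -/
def interleave [BraidedCategory C] (A B : C) :
    (n : ℕ) → (pow A n ⊗ pow B n ⟶ pow (A ⊗ B) n)
  | 0 => (λ_ (𝟙_ C)).hom
  | n + 1 => tensorμ A (pow A n) B (pow B n) ≫ (A ⊗ B) ◁ interleave A B n

/-- The multiplication `m_n = (m, …, m) ∘ F_n(ψ)` of the algebra `A^{⊗ n}`. -/
def mulPow [BraidedCategory C] (A : C) [MonObj A] (n : ℕ) : pow A n ⊗ pow A n ⟶ pow A n :=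
  interleave A A n ≫ powMap μ[A] n

/-! ### Modules and comodules -/

/-- A right module structure over the algebra `H` on the object `M`. -/
structure RightModule (H : C) [MonObj H] (M : C) where
  act : M ⊗ H ⟶ M
  act_one : M ◁ η[H] ≫ act = (ρ_ M).hom
  act_mul : M ◁ μ[H] ≫ act = (α_ M H H).inv ≫ act ▷ H ≫ act

/-- A left comodule structure over the coalgebra `H` on the object `M`. -/
structure LeftComodule (H : C) [ComonObj H] (M : C) where
  coact : M ⟶ H ⊗ M
  counit_coact : coact ≫ ε[H] ▷ M = (λ_ M).inv
  comul_coact : coact ≫ Δ[H] ▷ M = coact ≫ H ◁ coact ≫ (α_ H H M).inv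

/-- The action map `H ⊗ K ⟶ K` of a left `H`-module structure on `K`. -/
def leftAct {H K : C} [MonObj H] (b : ModObj H K) : H ⊗ K ⟶ K := b.smul

variable [BraidedCategory C]

/-- The coalgebra `K` with the left `H`-action `b` is a left `H`-module coalgebra: the action is a
coalgebra map. -/
structure IsModuleCoalgebra {H K : C} [HopfObj H] [ComonObj K] (b : ModObj H K) : Prop where
  act_comul : leftAct b ≫ Δ[K] =
    (Δ[H] ⊗ₘ Δ[K]) ≫ tensorμ H H K K ≫ (leftAct b ⊗ₘ leftAct b)
  act_counit : leftAct b ≫ ε[K] = (ε[H] ⊗ₘ ε[K]) ≫ (λ_ (𝟙_ C)).hom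

/-- `M` with the given right action and left coaction is a right-left braided stable
anti-Yetter–Drinfeld module over `H`. The composite in the first condition is, read from left to
right, `m ⊗ h ↦ m₋₁ ⊗ m₀ ⊗ h₁ ⊗ h₂ ⊗ h₃ ↦ m₋₁ ⊗ h₁ ⊗ m₀ ⊗ h₂ ⊗ h₃ ↦ m₋₁ ⊗ h₁ ⊗ m₀ ⊗ h₃ ⊗ h₂
↦ m₋₁ ⊗ h₁ ⊗ h₃ ⊗ m₀ ⊗ h₂ ↦ h₃ ⊗ m₋₁ ⊗ h₁ ⊗ m₀ ⊗ h₂ ↦ S(h₃) (m₋₁ h₁) ⊗ m₀ h₂`. -/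
structure IsSAYD {H M : C} [HopfObj H] (a : RightModule H M) (c : LeftComodule H M) : Prop where
  ayd : a.act ≫ c.coact =
    (c.coact ⊗ₘ (Δ[H] ≫ H ◁ Δ[H])) ⊗≫
    (H ◁ (β_ M H).hom ▷ (H ⊗ H)) ⊗≫
    ((H ⊗ H ⊗ M) ◁ (β_ H H).hom) ⊗≫
    ((H ⊗ H) ◁ (β_ M H).hom ▷ H) ⊗≫
    ((β_ (H ⊗ H) H).hom ▷ (M ⊗ H)) ⊗≫
    (((𝒮[H] ⊗ₘ μ[H]) ≫ μ[H]) ⊗ₘ a.act)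
  stable : c.coact ≫ (β_ H M).hom ≫ a.act = 𝟙 M

/-! ### The para-cocyclic object of a triple `(H, K, M)` -/

/-- The diagonal action `H ⊗ K^{⊗ (n+1)} ⟶ K^{⊗ (n+1)}`,
`(φ_K, …, φ_K) ∘ F(ψ_{H,K}) ∘ (Δ^n ⊗ 1)`. -/
def diagAct {H K : C} [HopfObj H] (b : ModObj H K) (n : ℕ) :
    H ⊗ pow K (n + 1) ⟶ pow K (n + 1) :=
  comulPow H n ▷ pow K (n + 1) ≫ interleave H K (n + 1) ≫ powMap (leftAct b) (n + 1)

/-- The composite `(1_M, ψ_{K, K^n}) (1_M, φ_K, 1_{K^n}) (ψ_{H,M}, 1_{K^{n+1}})`, that is,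
`h ⊗ m ⊗ k₀ ⊗ k₁ ⊗ ⋯ ⊗ kₙ ↦ m ⊗ k₁ ⊗ ⋯ ⊗ kₙ ⊗ h k₀`. -/
def rotate {H K : C} [HopfObj H] (b : ModObj H K) (M : C) (n : ℕ) :
    (H ⊗ M) ⊗ pow K (n + 1) ⟶ M ⊗ pow K (n + 1) :=
  (β_ H M).hom ▷ (K ⊗ pow K n) ≫ (α_ M H (K ⊗ pow K n)).hom ≫
    M ◁ ((α_ H K (pow K n)).inv ≫ leftAct b ▷ pow K n ≫
      (β_ K (pow K n)).hom ≫ (powSnoc K n).hom)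

/-- The structure maps on `C^n(K, M) = M ⊗ K^{⊗ (n+1)}`. -/
def tripleData {H K M : C} [HopfObj H] [ComonObj K] (b : ModObj H K)
    (c : LeftComodule H M) : CocyclicData C where
  X n := M ⊗ pow K (n + 1)
  δ n := Fin.lastCases
    ((c.coact ⊗ₘ comulAt K (n + 1) 0) ≫ rotate b M (n + 1))
    (fun i : Fin (n + 1) => M ◁ comulAt K (n + 1) i)
  σ n i := M ◁ counitAt K (n + 1) i.succ
  τ n := c.coact ▷ pow K (n + 1) ≫ rotate b M n

end Monoidal

/-! ### The cocyclic object on the balanced tensor products -/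

section Abelian

variable {C : Type u} [Category.{v} C] [Abelian C] [MonoidalCategory C] [BraidedCategory C]

/-- The map `φ_M ⊗ 1 - 1 ⊗ φ_{K^{n+1}} : M ⊗ H ⊗ K^{⊗ (n+1)} ⟶ M ⊗ K^{⊗ (n+1)}`. -/
def balancedMap {H K M : C} [HopfObj H] (b : ModObj H K) (a : RightModule H M) (n : ℕ) :
    (M ⊗ H) ⊗ pow K (n + 1) ⟶ M ⊗ pow K (n + 1) :=
  a.act ▷ pow K (n + 1) - (α_ M H (pow K (n + 1))).hom ≫ M ◁ diagAct b n

/-- The balanced tensor product `M ⊗_H K^{⊗ (n+1)}`. -/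
def balanced {H K M : C} [HopfObj H] (b : ModObj H K) (a : RightModule H M) (n : ℕ) : C :=
  cokernel (balancedMap b a n)

/-- The projection `M ⊗ K^{⊗ (n+1)} ⟶ M ⊗_H K^{⊗ (n+1)}`. -/
def balancedProj {H K M : C} [HopfObj H] (b : ModObj H K) (a : RightModule H M) (n : ℕ) :
    M ⊗ pow K (n + 1) ⟶ balanced b a n :=
  cokernel.π (balancedMap b a n)

/-- The faces, degeneracies and cyclic maps on the objects `M ⊗_H K^{⊗ (n+1)}` induced by those on
`M ⊗ K^{⊗ (n+1)}`. They are unique as soon as they exist, the projections being epimorphisms. -/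
structure InducedMaps {H K M : C} [HopfObj H] [ComonObj K] (b : ModObj H K)
    (a : RightModule H M) (c : LeftComodule H M) where
  δ : ∀ n : ℕ, Fin (n + 2) → (balanced b a n ⟶ balanced b a (n + 1))
  σ : ∀ n : ℕ, Fin (n + 1) → (balanced b a (n + 1) ⟶ balanced b a n)
  τ : ∀ n : ℕ, balanced b a n ⟶ balanced b a n
  proj_δ : ∀ (n : ℕ) (i : Fin (n + 2)),
    balancedProj b a n ≫ δ n i = (tripleData b c).δ n i ≫ balancedProj b a (n + 1)
  proj_σ : ∀ (n : ℕ) (i : Fin (n + 1)),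
    balancedProj b a (n + 1) ≫ σ n i = (tripleData b c).σ n i ≫ balancedProj b a n
  proj_τ : ∀ n : ℕ, balancedProj b a n ≫ τ n = (tripleData b c).τ n ≫ balancedProj b a n

/-- The objects `M ⊗_H K^{⊗ (n+1)}` with the induced maps. -/
def InducedMaps.toCocyclicData {H K M : C} [HopfObj H] [ComonObj K] {b : ModObj H K}
    {a : RightModule H M} {c : LeftComodule H M} (T : InducedMaps b a c) : CocyclicData C where
  X n := balanced b a n
  δ := T.δ
  σ := T.σ
  τ := T.τ

end Abelian

/-! ### Modular pairs in involution and the module `^σI_δ` -/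

section ModularPair

variable {C : Type u} [Category.{v} C] [MonoidalCategory C] [BraidedCategory C]
  {H : C} [HopfObj H]

/-- Characters: algebra maps `δ : H ⟶ 𝟙_ C`. -/
structure IsCharacter (δ : H ⟶ 𝟙_ C) : Prop where
  mul : μ[H] ≫ δ = (δ ⊗ₘ δ) ≫ (λ_ (𝟙_ C)).hom
  one : η[H] ≫ δ = 𝟙 (𝟙_ C)

/-- Co-characters: coalgebra maps `σ : 𝟙_ C ⟶ H`. -/
structure IsCocharacter (σ : 𝟙_ C ⟶ H) : Prop where
  comul : σ ≫ Δ[H] = (λ_ (𝟙_ C)).inv ≫ (σ ⊗ₘ σ)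
  counit : σ ≫ ε[H] = 𝟙 (𝟙_ C)

/-- The `δ`-twisted antipode `S̃ = (δ ⊗ S) Δ`. -/
def twistedAntipode (δ : H ⟶ 𝟙_ C) : H ⟶ H :=
  Δ[H] ≫ (δ ⊗ₘ 𝒮[H]) ≫ (λ_ H).hom

/-- `(δ, σ)` is a braided modular pair in involution: `δ` is a character, `σ` a co-character,
`δ σ = id` and `m (m ⊗ id) (S σ ⊗ S̃² ⊗ σ) = id`. -/
structure IsBraidedMPI (δ : H ⟶ 𝟙_ C) (σ : 𝟙_ C ⟶ H) : Prop where
  character : IsCharacter δ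
  cocharacter : IsCocharacter σ
  modular : σ ≫ δ = 𝟙 (𝟙_ C)
  involution : (λ_ H).inv ≫ (ρ_ (𝟙_ C ⊗ H)).inv ≫
    (((σ ≫ 𝒮[H]) ⊗ₘ (twistedAntipode δ ≫ twistedAntipode δ)) ⊗ₘ σ) ≫
    μ[H] ▷ H ≫ μ[H] = 𝟙 H

/-- The unit object as a right `H`-module through a character. -/
def characterModule {δ : H ⟶ 𝟙_ C} (hδ : IsCharacter δ) : RightModule H (𝟙_ C) where
  act := (λ_ H).hom ≫ δ
  act_one := by
    rw [← Category.assoc, leftUnitor_naturality, Category.assoc, hδ.one]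
    simp [unitors_equal]
  act_mul := by
    rw [← Category.assoc, leftUnitor_naturality, Category.assoc, hδ.mul]
    simp [MonoidalCategory.tensorHom_def]

/-- The unit object as a left `H`-comodule through a co-character. -/
def cocharacterComodule {σ : 𝟙_ C ⟶ H} (hσ : IsCocharacter σ) : LeftComodule H (𝟙_ C) where
  coact := σ ≫ (ρ_ H).inv
  counit_coact := by
    rw [Category.assoc, ← rightUnitor_inv_naturality, ← Category.assoc, hσ.counit]
    simp [unitors_inv_equal]
  comul_coact := by
    rw [Category.assoc, ← rightUnitor_inv_naturality, ← Category.assoc, hσ.comul]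
    simp [MonoidalCategory.tensorHom_def, unitors_inv_equal]

/-! ### The braided Connes–Moscovici cocyclic object -/

/-- The map `(1, …, 1, σ) : H^{⊗ n} ⟶ H^{⊗ (n+1)}`. -/
def snocMap (σ : 𝟙_ C ⟶ H) (n : ℕ) : pow H n ⟶ pow H (n + 1) :=
  (ρ_ (pow H n)).inv ≫ pow H n ◁ σ ≫ (powSnoc H n).hom

/-- The map `(η, 1, …, 1) : H^{⊗ n} ⟶ H^{⊗ (n+1)}`. -/
def consUnit (H : C) [HopfObj H] (n : ℕ) : pow H n ⟶ pow H (n + 1) :=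
  (λ_ (pow H n)).inv ≫ η[H] ▷ pow H n

/-- The cyclic map: `τ_0 = id` and `τ_n = m_n (Δ^{n-1} S̃, 1_{H^{n-1}}, σ)` for `n ≥ 1`. -/
def cmTau (δ : H ⟶ 𝟙_ C) (σ : 𝟙_ C ⟶ H) : (n : ℕ) → (pow H n ⟶ pow H n)
  | 0 => 𝟙 (𝟙_ C)
  | n + 1 => ((twistedAntipode δ ≫ comulPow H n) ⊗ₘ snocMap σ n) ≫ mulPow H (n + 1)

/-- The braided Connes–Moscovici data on the objects `H^{⊗ n}`: the coface `δ_0` is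
`(η, 1, …, 1)`, the last one is `(1, …, 1, σ)`, and the inner ones apply `Δ` to the `i`-th factor;
the codegeneracy `σ_i` applies `ε` to the `(i+1)`-st factor. -/
def cmData (δ : H ⟶ 𝟙_ C) (σ : 𝟙_ C ⟶ H) : CocyclicData C where
  X n := pow H n
  δ n := Fin.cases (consUnit H n)
    (fun j : Fin (n + 1) => Fin.lastCases (snocMap σ n) (fun k : Fin n => comulAt H n k) j)
  σ n i := counitAt H n i
  τ n := cmTau δ σ n

end ModularPair

end

end BraidedHopfCyclic

namespace BraidedHopfCyclic

noncomputable section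

/-! ### Paracocyclic objects -/

/-! Over the unit object the coaction only inserts `σ`, so on `H^{n+1}` the cyclic map is the
rotation `a₀ ⊗ ⋯ ⊗ aₙ ↦ a₁ ⊗ ⋯ ⊗ aₙ ⊗ L a₀` with `L a = σ a`. Since `σ` is group-like, `L` is a
coalgebra endomorphism. For every coalgebra endomorphism `L`, the comultiplications, counits and
rotations satisfy all cocyclic identities except the last (`isParacocyclic_rotData`), while the
symmetry of the category gives `τ^{n+1} = L^{⊗(n+1)}` (`homPow_rot`).

The balanced product is the quotient of the algebra `H^{n+1}` by `Δ(h) x = δ(h) x`, where `Δ(h)` is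
the iterated coproduct. Maps out of it are the maps `q` satisfying `IsBalanced`; no exactness of the
tensor product is needed. Faces with comultiplications and degeneracies descend because they are
algebra maps compatible with iterated coproducts. The rotation descends because `h x ⊗ y = x ⊗ S̃(h)
y` in the quotient (`ActEq.swap`) and because the modular pair gives `S̃(h₂) σ h₁ = δ(h) σ`
(`actEq_rotation`). In the quotient `L^{⊗(n+1)}`, being the diagonal action of `σ`, becomes the
scalar `δσ = 1`, so `τ^{n+1} = 1` there.

Finally `h ⊗ x ↦ S̃(h) x`, with section `x ↦ 1 ⊗ x`, identifies the quotient with `H^n`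
(`balancedIso`). Carried through the section, the rotation becomes `x ↦ x ⊗ σ` followed by the
retraction, which is the Connes–Moscovici operator (`snocMap_powRetraction`). Cocyclicity of the
latter object is transported, never checked directly. -/

/-- The axioms of a cocyclic object except `τ_n ^ (n+1) = id`. -/
structure CocyclicData.IsParacocyclic {C : Type u} [Category.{v} C] (D : CocyclicData C) :
    Prop where
  δ_comp_δ : ∀ (n : ℕ) (i j : Fin (n + 2)), i ≤ j →
    D.δ n i ≫ D.δ (n + 1) j.succ = D.δ n j ≫ D.δ (n + 1) i.castSucc
  σ_comp_σ : ∀ (n : ℕ) (i j : Fin (n + 1)), i ≤ j →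
    D.σ (n + 1) i.castSucc ≫ D.σ n j = D.σ (n + 1) j.succ ≫ D.σ n i
  δ_comp_σ_of_le : ∀ (n : ℕ) (i : Fin (n + 2)) (j : Fin (n + 1)), i ≤ j.castSucc →
    D.δ (n + 1) i.castSucc ≫ D.σ (n + 1) j.succ = D.σ n j ≫ D.δ n i
  δ_comp_σ_self : ∀ (n : ℕ) (i : Fin (n + 1)), D.δ n i.castSucc ≫ D.σ n i = 𝟙 (D.X n)
  δ_comp_σ_succ : ∀ (n : ℕ) (i : Fin (n + 1)), D.δ n i.succ ≫ D.σ n i = 𝟙 (D.X n)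
  δ_comp_σ_of_gt : ∀ (n : ℕ) (i : Fin (n + 2)) (j : Fin (n + 1)), j.castSucc < i →
    D.δ (n + 1) i.succ ≫ D.σ (n + 1) j.castSucc = D.σ n j ≫ D.δ n i
  δ_succ_comp_τ : ∀ (n : ℕ) (i : Fin (n + 1)),
    D.δ n i.succ ≫ D.τ (n + 1) = D.τ n ≫ D.δ n i.castSucc
  δ_zero_comp_τ : ∀ n : ℕ, D.δ n 0 ≫ D.τ (n + 1) = D.δ n (Fin.last (n + 1))
  σ_succ_comp_τ : ∀ (n : ℕ) (i : Fin n),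
    D.σ n i.succ ≫ D.τ n = D.τ (n + 1) ≫ D.σ n i.castSucc
  σ_zero_comp_τ : ∀ n : ℕ,
    D.σ n 0 ≫ D.τ n = D.τ (n + 1) ≫ D.τ (n + 1) ≫ D.σ n (Fin.last n)

theorem CocyclicData.IsParacocyclic.isCocyclic {C : Type u} [Category.{v} C] {D : CocyclicData C}
    (h : D.IsParacocyclic) (hτ : ∀ n : ℕ, (show End (D.X n) from D.τ n) ^ (n + 1) = 1) :
    D.IsCocyclic :=
  { h with τ_pow := hτ }

theorem CocyclicData.IsCocyclic.isParacocyclic {C : Type u} [Category.{v} C] {D : CocyclicData C}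
    (h : D.IsCocyclic) : D.IsParacocyclic :=
  { h with }

/-- The paracocyclic identities descend along degreewise epimorphisms. -/
theorem CocyclicData.IsParacocyclic.of_epi {C : Type u} [Category.{v} C] {D E : CocyclicData C}
    (h : D.IsParacocyclic) (p : ∀ n, D.X n ⟶ E.X n) [∀ n, Epi (p n)]
    (hδ : ∀ n i, p n ≫ E.δ n i = D.δ n i ≫ p (n + 1))
    (hσ : ∀ n i, p (n + 1) ≫ E.σ n i = D.σ n i ≫ p n)
    (hτ : ∀ n, p n ≫ E.τ n = D.τ n ≫ p n) : E.IsParacocyclic where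
  δ_comp_δ n i j hij := by
    rw [← cancel_epi (p _)]
    simp only [reassoc_of% hδ, hδ, reassoc_of% (h.δ_comp_δ n i j hij)]
  σ_comp_σ n i j hij := by
    rw [← cancel_epi (p _)]
    simp only [reassoc_of% hσ, hσ, reassoc_of% (h.σ_comp_σ n i j hij)]
  δ_comp_σ_of_le n i j hij := by
    rw [← cancel_epi (p _)]
    simp only [reassoc_of% hσ, hσ, reassoc_of% hδ, hδ, reassoc_of% (h.δ_comp_σ_of_le n i j hij)]
  δ_comp_σ_self n i := by
    rw [← cancel_epi (p _)]
    simp only [hσ, reassoc_of% hδ, reassoc_of% (h.δ_comp_σ_self n i), Category.comp_id]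
  δ_comp_σ_succ n i := by
    rw [← cancel_epi (p _)]
    simp only [hσ, reassoc_of% hδ, reassoc_of% (h.δ_comp_σ_succ n i), Category.comp_id]
  δ_comp_σ_of_gt n i j hij := by
    rw [← cancel_epi (p _)]
    simp only [reassoc_of% hσ, hσ, reassoc_of% hδ, hδ, reassoc_of% (h.δ_comp_σ_of_gt n i j hij)]
  δ_succ_comp_τ n i := by
    rw [← cancel_epi (p _)]
    simp only [reassoc_of% hτ, hτ, reassoc_of% hδ, hδ, reassoc_of% (h.δ_succ_comp_τ n i)]
  δ_zero_comp_τ n := by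
    rw [← cancel_epi (p _)]
    simp only [hτ, reassoc_of% hδ, hδ, reassoc_of% (h.δ_zero_comp_τ n)]
  σ_succ_comp_τ n i := by
    rw [← cancel_epi (p _)]
    simp only [reassoc_of% hτ, hτ, reassoc_of% hσ, hσ, reassoc_of% (h.σ_succ_comp_τ n i)]
  σ_zero_comp_τ n := by
    rw [← cancel_epi (p _)]
    simp only [reassoc_of% hτ, hτ, reassoc_of% hσ, hσ, reassoc_of% (h.σ_zero_comp_τ n)]

/-- The relation `τ^{n+1} = 1` fails before passing to the quotient, so powers of `τ` have to be
compared across the projection. -/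
theorem comp_end_pow {C : Type u} [Category.{v} C] {X Y : C} (p : X ⟶ Y) (f : End X) (g : End Y)
    (h : p ≫ g = f ≫ p) (n : ℕ) : p ≫ (g ^ n : End Y) = (f ^ n : End X) ≫ p := by
  induction n with
  | zero => exact (Category.comp_id p).trans (Category.id_comp p).symm
  | succ n ih =>
    rw [pow_succ, pow_succ, End.mul_def, End.mul_def, reassoc_of% h, ih, Category.assoc]

/-- Being cocyclic is invariant under isomorphism. -/
theorem CocyclicData.Iso.isCocyclic {C : Type u} [Category.{v} C] {D E : CocyclicData C}
    (e : D.Iso E) (h : D.IsCocyclic) : E.IsCocyclic := by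
  refine (h.isParacocyclic.of_epi (fun n => (e.iso n).hom) (fun n i => (e.comm_δ n i).symm)
    (fun n i => (e.comm_σ n i).symm) (fun n => (e.comm_τ n).symm)).isCocyclic fun n => ?_
  have := comp_end_pow (e.iso n).hom (D.τ n) (E.τ n) (e.comm_τ n).symm (n + 1)
  rw [← cancel_epi (e.iso n).hom]
  refine this.trans ?_
  rw [show (show End (D.X n) from D.τ n) ^ (n + 1) = 1 from h.τ_pow n]
  exact (Category.id_comp _).trans (Category.comp_id _).symm

/-! ### The paracocyclic object of a coalgebra with a coalgebra endomorphism -/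

section Coalgebra

variable {C : Type u} [Category.{v} C] [MonoidalCategory C]

section Monoidal

/-- This and the next two lemmas are inductive steps for identities on tensor powers. They are
stated for arbitrary objects, so that `pow A (n + 1)` is matched with `A ⊗ pow A n` by definitional
unfolding. -/
theorem whiskerLeft_square (A : C) {P Q Q' R : C} {f : P ⟶ Q} {g : Q ⟶ R} {f' : P ⟶ Q'}
    {g' : Q' ⟶ R} (h : f ≫ g = f' ≫ g') : A ◁ f ≫ A ◁ g = A ◁ f' ≫ A ◁ g' := by
  rw [← whiskerLeft_comp, h, whiskerLeft_comp]

theorem whiskerLeft_section (A : C) {P Q : C} {f : P ⟶ Q} {g : Q ⟶ P} (h : f ≫ g = 𝟙 P) :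
    A ◁ f ≫ A ◁ g = 𝟙 (A ⊗ P) := by
  rw [← whiskerLeft_comp, h, whiskerLeft_id]

theorem whiskerLeft_snoc_square (A : C) {P P' Q Q' : C} {f : P ⟶ P'} {s : P ⊗ A ⟶ Q}
    {s' : P' ⊗ A ⟶ Q'} {g : Q ⟶ Q'} (h : f ▷ A ≫ s' = s ≫ g) :
    (A ◁ f) ▷ A ≫ (α_ A P' A).hom ≫ A ◁ s' = ((α_ A P A).hom ≫ A ◁ s) ≫ A ◁ g := by
  rw [Category.assoc, ← whiskerLeft_comp, ← h]
  simp

variable (A : C) [ComonObj A]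

/-- Comultiply the first factor. -/
def comulHead (P : C) : A ⊗ P ⟶ A ⊗ A ⊗ P := Δ[A] ▷ P ≫ (α_ A A P).hom

/-- Delete the first factor. -/
def counitHead (P : C) : A ⊗ P ⟶ P := ε[A] ▷ P ≫ (λ_ P).hom

variable {A} in
theorem comulHead_naturality {P Q : C} (f : P ⟶ Q) :
    A ◁ f ≫ comulHead A Q = comulHead A P ≫ A ◁ A ◁ f := by
  simp [comulHead, whisker_exchange_assoc]

variable {A} in
theorem counitHead_naturality {P Q : C} (f : P ⟶ Q) :
    A ◁ f ≫ counitHead A Q = counitHead A P ≫ f := by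
  simp only [counitHead, whisker_exchange_assoc, leftUnitor_naturality, Category.assoc]

theorem comulHead_comp_whiskerLeft_comulHead (P : C) :
    comulHead A P ≫ A ◁ comulHead A P = comulHead A P ≫ comulHead A (A ⊗ P) := by
  have h : Δ[A] ▷ P ≫ (A ◁ Δ[A]) ▷ P = Δ[A] ▷ P ≫ (Δ[A] ▷ A ≫ (α_ A A A).hom) ▷ P := by
    rw [← comp_whiskerRight, ComonObj.comul_assoc, comp_whiskerRight]
  have h' := h =≫ ((α_ A (A ⊗ A) P).hom ≫ A ◁ (α_ A A P).hom)
  simpa [comulHead] using h'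

theorem comulHead_comp_counitHead (P : C) : comulHead A P ≫ counitHead A (A ⊗ P) = 𝟙 _ := by
  have h : Δ[A] ▷ P ≫ (ε[A] ▷ A) ▷ P = (λ_ A).inv ▷ P := by
    rw [← comp_whiskerRight, ComonObj.counit_comul]
  have h' := h =≫ ((α_ (𝟙_ C) A P).hom ≫ (λ_ (A ⊗ P)).hom)
  simpa [comulHead, counitHead] using h'

theorem comulHead_comp_whiskerLeft_counitHead (P : C) :
    comulHead A P ≫ A ◁ counitHead A P = 𝟙 _ := by
  have h : Δ[A] ▷ P ≫ (A ◁ ε[A]) ▷ P = (ρ_ A).inv ▷ P := by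
    rw [← comp_whiskerRight, ComonObj.comul_counit]
  have h' := h =≫ ((α_ A (𝟙_ C) P).hom ≫ A ◁ (λ_ P).hom)
  simpa [comulHead, counitHead] using h'

theorem comulHead_snoc {P Q : C} (s : P ⊗ A ⟶ Q) :
    comulHead A P ▷ A ≫ (α_ A (A ⊗ P) A).hom ≫ A ◁ ((α_ A P A).hom ≫ A ◁ s) =
      ((α_ A P A).hom ≫ A ◁ s) ≫ comulHead A Q := by
  rw [Category.assoc, comulHead_naturality]
  simp [comulHead]

theorem counitHead_snoc {P Q : C} (s : P ⊗ A ⟶ Q) :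
    counitHead A P ▷ A ≫ s = ((α_ A P A).hom ≫ A ◁ s) ≫ counitHead A Q := by
  rw [Category.assoc, counitHead_naturality]
  simp [counitHead]

theorem counitAt_zero (n : ℕ) : counitAt A n 0 = counitHead A (pow A n) := by
  cases n <;> rfl

theorem counitAt_succ (n : ℕ) (i : Fin (n + 1)) :
    counitAt A (n + 1) i.succ = A ◁ counitAt A n i := rfl

/-- Peeling off the first factor leaves two genuine cases: coassociativity when both positions are
`0`, and naturality when only `i` is. -/
theorem comulAt_comp_comulAt (n : ℕ) (i j : Fin n) (hij : i ≤ j) :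
    comulAt A n i ≫ comulAt A (n + 1) j.succ = comulAt A n j ≫ comulAt A (n + 1) i.castSucc := by
  induction n with
  | zero => exact i.elim0
  | succ n ih =>
    cases i using Fin.cases with
    | zero =>
      cases j using Fin.cases with
      | zero => exact comulHead_comp_whiskerLeft_comulHead A (pow A n)
      | succ j => exact (comulHead_naturality (comulAt A n j)).symm
    | succ i =>
      cases j using Fin.cases with
      | zero => exact absurd hij (by simp)
      | succ j => exact whiskerLeft_square A (ih i j (by simpa using hij))

theorem counitAt_comp_counitAt (n : ℕ) (i j : Fin (n + 1)) (hij : i ≤ j) :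
    counitAt A (n + 1) i.castSucc ≫ counitAt A n j =
      counitAt A (n + 1) j.succ ≫ counitAt A n i := by
  induction n with
  | zero =>
    obtain rfl := Fin.fin_one_eq_zero i
    exact (counitHead_naturality (counitAt A 0 j)).symm
  | succ n ih =>
    cases i using Fin.cases with
    | zero => exact (counitHead_naturality (counitAt A (n + 1) j)).symm
    | succ i =>
      cases j using Fin.cases with
      | zero => exact absurd hij (by simp)
      | succ j => exact whiskerLeft_square A (ih i j (by simpa using hij))

theorem comulAt_comp_counitAt_of_le (n : ℕ) (i j : Fin (n + 1)) (hij : i ≤ j) :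
    comulAt A (n + 2) i.castSucc ≫ counitAt A (n + 2) j.succ.succ =
      counitAt A (n + 1) j.succ ≫ comulAt A (n + 1) i := by
  induction n with
  | zero =>
    obtain rfl := Fin.fin_one_eq_zero i
    exact (comulHead_naturality (counitAt A 0 j)).symm
  | succ n ih =>
    cases i using Fin.cases with
    | zero => exact (comulHead_naturality (counitAt A (n + 1) j)).symm
    | succ i =>
      cases j using Fin.cases with
      | zero => exact absurd hij (by simp)
      | succ j => exact whiskerLeft_square A (ih i j (by simpa using hij))

theorem comulAt_comp_counitAt_self (n : ℕ) (i : Fin n) :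
    comulAt A n i ≫ counitAt A n i.castSucc = 𝟙 (pow A n) := by
  induction n with
  | zero => exact i.elim0
  | succ n ih =>
    cases i using Fin.cases with
    | zero => exact comulHead_comp_counitHead A (pow A n)
    | succ i => exact whiskerLeft_section A (ih i)

theorem comulAt_comp_counitAt_succ (n : ℕ) (i : Fin n) :
    comulAt A n i ≫ counitAt A n i.succ = 𝟙 (pow A n) := by
  induction n with
  | zero => exact i.elim0
  | succ n ih =>
    cases i using Fin.cases with
    | zero =>
      rw [counitAt_succ, counitAt_zero]
      exact comulHead_comp_whiskerLeft_counitHead A (pow A n)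
    | succ i => exact whiskerLeft_section A (ih i)

theorem comulAt_comp_counitAt_of_gt (n : ℕ) (i : Fin n) (j : Fin (n + 1)) (hij : j ≤ i.castSucc) :
    comulAt A (n + 1) i.succ ≫ counitAt A (n + 1) j.castSucc = counitAt A n j ≫ comulAt A n i := by
  induction n with
  | zero => exact i.elim0
  | succ n ih =>
    cases j using Fin.cases with
    | zero => exact counitHead_naturality (comulAt A (n + 1) i)
    | succ j =>
      cases i using Fin.cases with
      | zero => exact absurd hij (by simp)
      | succ i => exact whiskerLeft_square A (ih i j (by simpa [Fin.le_def] using hij))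

/-! ### Adding a last factor -/

theorem comulAt_whiskerRight_powSnoc (n : ℕ) (i : Fin n) :
    comulAt A n i ▷ A ≫ (powSnoc A (n + 1)).hom =
      (powSnoc A n).hom ≫ comulAt A (n + 1) i.castSucc := by
  induction n with
  | zero => exact i.elim0
  | succ n ih =>
    cases i using Fin.cases with
    | zero => exact comulHead_snoc A (powSnoc A n).hom
    | succ i => exact whiskerLeft_snoc_square A (ih i)

theorem whiskerLeft_comul_powSnoc (n : ℕ) :
    pow A n ◁ Δ[A] ≫ (α_ (pow A n) A A).inv ≫ (powSnoc A n).hom ▷ A ≫ (powSnoc A (n + 1)).hom =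
      (powSnoc A n).hom ≫ comulAt A (n + 1) (Fin.last n) := by
  induction n with
  | zero =>
    change 𝟙_ C ◁ Δ[A] ≫ (α_ (𝟙_ C) A A).inv ≫ ((λ_ A).hom ≫ (ρ_ A).inv) ▷ A ≫
      (α_ A (𝟙_ C) A).hom ≫ A ◁ ((λ_ A).hom ≫ (ρ_ A).inv) =
      ((λ_ A).hom ≫ (ρ_ A).inv) ≫ Δ[A] ▷ 𝟙_ C ≫ (α_ A A (𝟙_ C)).hom
    simp
  | succ n ih =>
    have key {P Q R : C} (s : P ⊗ A ⟶ Q) (s' : Q ⊗ A ⟶ R) (d : Q ⟶ R)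
        (h : P ◁ Δ[A] ≫ (α_ P A A).inv ≫ s ▷ A ≫ s' = s ≫ d) :
        (A ⊗ P) ◁ Δ[A] ≫ (α_ (A ⊗ P) A A).inv ≫ ((α_ A P A).hom ≫ A ◁ s) ▷ A ≫
          (α_ A Q A).hom ≫ A ◁ s' = ((α_ A P A).hom ≫ A ◁ s) ≫ A ◁ d := by
      rw [Category.assoc, ← whiskerLeft_comp, ← h]
      simp
    exact key _ _ _ ih

theorem counitAt_whiskerRight_powSnoc (n : ℕ) (i : Fin (n + 1)) :
    counitAt A n i ▷ A ≫ (powSnoc A n).hom =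
      (powSnoc A (n + 1)).hom ≫ counitAt A (n + 1) i.castSucc := by
  induction n with
  | zero =>
    obtain rfl := Fin.fin_one_eq_zero i
    exact counitHead_snoc A (powSnoc A 0).hom
  | succ n ih =>
    cases i using Fin.cases with
    | zero => exact counitHead_snoc A (powSnoc A (n + 1)).hom
    | succ i => exact whiskerLeft_snoc_square A (ih i)

theorem powSnoc_counitAt_last (n : ℕ) :
    (powSnoc A n).hom ≫ counitAt A n (Fin.last n) = pow A n ◁ ε[A] ≫ (ρ_ (pow A n)).hom := by
  induction n with
  | zero =>
    change ((λ_ A).hom ≫ (ρ_ A).inv) ≫ ε[A] ▷ 𝟙_ C ≫ (λ_ (𝟙_ C)).hom =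
      𝟙_ C ◁ ε[A] ≫ (ρ_ (𝟙_ C)).hom
    simp [unitors_equal, unitors_inv_equal]
  | succ n ih =>
    have key {P Q : C} (s : P ⊗ A ⟶ Q) (d : Q ⟶ P) (h : s ≫ d = P ◁ ε[A] ≫ (ρ_ P).hom) :
        ((α_ A P A).hom ≫ A ◁ s) ≫ A ◁ d = (A ⊗ P) ◁ ε[A] ≫ (ρ_ (A ⊗ P)).hom := by
      rw [Category.assoc, ← whiskerLeft_comp, h]
      simp
    exact key _ _ ih

end Monoidal

end Coalgebra

/-! ### Twisted rotations and their powers -/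

section Rotation

/-- The iterates of an endomorphism. -/
def homPow {C : Type u} [Category.{v} C] {X : C} (f : X ⟶ X) : ℕ → (X ⟶ X)
  | 0 => 𝟙 X
  | n + 1 => f ≫ homPow f n

theorem end_pow_eq_homPow {C : Type u} [Category.{v} C] {X : C} (f : X ⟶ X) (n : ℕ) :
    (show End X from f) ^ n = homPow f n := by
  induction n with
  | zero => rfl
  | succ n ih => rw [pow_succ, ih]; rfl

variable {C : Type u} [Category.{v} C] [MonoidalCategory C]

section Braided

variable [BraidedCategory C]

/-- `a₀ ⊗ ⋯ ⊗ aₙ ↦ a₁ ⊗ ⋯ ⊗ aₙ ⊗ L a₀`. -/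
def rot {A : C} (L : A ⟶ A) (n : ℕ) : pow A (n + 1) ⟶ pow A (n + 1) :=
  L ▷ pow A n ≫ (β_ A (pow A n)).hom ≫ (powSnoc A n).hom

/-- By naturality of the braiding, a map on the tail does not interact with the head that moves past
it; `h` says that `g` is `f` with an idle last factor. -/
theorem whiskerLeft_comp_rot {A : C} (L : A ⟶ A) {m n : ℕ} {f : pow A m ⟶ pow A n}
    {g : pow A (m + 1) ⟶ pow A (n + 1)}
    (h : f ▷ A ≫ (powSnoc A n).hom = (powSnoc A m).hom ≫ g) :
    A ◁ f ≫ rot L n = rot L m ≫ g := by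
  have key {P P' Q Q' : C} (f : P ⟶ P') (s : P ⊗ A ⟶ Q) (s' : P' ⊗ A ⟶ Q') (g : Q ⟶ Q')
      (h : f ▷ A ≫ s' = s ≫ g) :
      A ◁ f ≫ L ▷ P' ≫ (β_ A P').hom ≫ s' = (L ▷ P ≫ (β_ A P).hom ≫ s) ≫ g := by
    simp only [Category.assoc]
    rw [← h, whisker_exchange_assoc, BraidedCategory.braiding_naturality_right_assoc]
  exact key _ _ _ _ h

theorem rot_counitAt_last {A : C} [ComonObj A] {L : A ⟶ A} (hL : L ≫ ε[A] = ε[A]) (n : ℕ) :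
    rot L n ≫ counitAt A n (Fin.last n) = counitAt A n 0 := by
  have key {P Q : C} (s : P ⊗ A ⟶ Q) (d : Q ⟶ P) (h : s ≫ d = P ◁ ε[A] ≫ (ρ_ P).hom) :
      (L ▷ P ≫ (β_ A P).hom ≫ s) ≫ d = counitHead A P := by
    simp only [Category.assoc]
    rw [h, ← BraidedCategory.braiding_naturality_left_assoc, ← comp_whiskerRight_assoc, hL,
      counitHead]
    simp
  rw [counitAt_zero]
  exact key _ _ (powSnoc_counitAt_last A n)

end Braided

section Symmetric

variable [SymmetricCategory C]

/-- On the left `X` and `Y` cross twice, in opposite directions; by symmetry these crossings cancel,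
and `X ⊗ Y` has moved past `Z`. -/
theorem braiding_braiding_cyclic (X Y Z : C) :
    (α_ X Y Z).hom ≫ (β_ X (Y ⊗ Z)).hom ≫ (α_ Y Z X).hom ≫ (β_ Y (Z ⊗ X)).hom =
      (β_ (X ⊗ Y) Z).hom ≫ (α_ Z X Y).inv := by
  rw [BraidedCategory.braiding_tensor_right_hom X Y Z]
  simp only [Category.assoc, Iso.inv_hom_id_assoc, Iso.hom_inv_id_assoc,
    BraidedCategory.braiding_naturality_right]
  rw [BraidedCategory.braiding_tensor_right_hom Y X Z]
  simp only [Category.assoc, Iso.hom_inv_id_assoc]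
  rw [← comp_whiskerRight_assoc, SymmetricCategory.symmetry,
    BraidedCategory.braiding_tensor_left_hom]
  simp

/-- Two rotations carry both halves of the comultiplied head to the end in their original order, and
`hL` merges the two copies of `L` into one applied beforehand. -/
theorem comulAt_zero_rot_rot {A : C} [ComonObj A] {L : A ⟶ A} (hL : L ≫ Δ[A] = Δ[A] ≫ (L ⊗ₘ L))
    (n : ℕ) :
    comulAt A (n + 1) 0 ≫ rot L (n + 1) ≫ rot L (n + 1) =
      rot L n ≫ comulAt A (n + 1) (Fin.last n) := by
  have key {P Q R : C} (s : P ⊗ A ⟶ Q) (s' : Q ⊗ A ⟶ R) (d : Q ⟶ R)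
      (h : P ◁ Δ[A] ≫ (α_ P A A).inv ≫ s ▷ A ≫ s' = s ≫ d) :
      (Δ[A] ▷ P ≫ (α_ A A P).hom) ≫ (L ▷ (A ⊗ P) ≫ (β_ A (A ⊗ P)).hom ≫ (α_ A P A).hom ≫ A ◁ s) ≫
        L ▷ Q ≫ (β_ A Q).hom ≫ s' =
      (L ▷ P ≫ (β_ A P).hom ≫ s) ≫ d := by
    have h' : Δ[A] ▷ P ≫ (α_ A A P).hom ≫ L ▷ (A ⊗ P) ≫ A ◁ L ▷ P =
        L ▷ P ≫ Δ[A] ▷ P ≫ (α_ A A P).hom := by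
      rw [← comp_whiskerRight_assoc, hL, MonoidalCategory.tensorHom_def]
      simp
    simp only [Category.assoc]
    rw [whisker_exchange_assoc, BraidedCategory.braiding_naturality_right_assoc,
      ← associator_naturality_left_assoc L P A, ← BraidedCategory.braiding_naturality_right_assoc,
      reassoc_of% h', reassoc_of% (braiding_braiding_cyclic A A P),
      BraidedCategory.braiding_naturality_left_assoc, ← h]
  exact key _ _ _ (whiskerLeft_comul_powSnoc A n)

/-- Insert a factor at position `k`: `a ⊗ x₀ ⊗ x₁ ⊗ ⋯ ↦ x₀ ⊗ ⋯ ⊗ a ⊗ x_k ⊗ ⋯`. -/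
def insertAt (A : C) : (n k : ℕ) → (A ⊗ pow A n ⟶ pow A (n + 1))
  | n, 0 => 𝟙 (A ⊗ pow A n)
  | 0, _ + 1 => 𝟙 (A ⊗ 𝟙_ C)
  | n + 1, k + 1 => (α_ A A (pow A n)).inv ≫ (β_ A A).hom ▷ pow A n ≫ (α_ A A (pow A n)).hom ≫
      A ◁ insertAt A n k

theorem insertAt_whiskerRight_powSnoc (A : C) (n k : ℕ) (hk : k ≤ n) :
    insertAt A n k ▷ A ≫ (powSnoc A (n + 1)).hom =
      (α_ A (pow A n) A).hom ≫ A ◁ (powSnoc A n).hom ≫ insertAt A (n + 1) k := by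
  induction n generalizing k with
  | zero =>
    obtain rfl : k = 0 := by omega
    simp only [insertAt]
    exact (congrArg (· ≫ _) (id_whiskerRight _ _)).trans ((Category.id_comp _).trans
      (congrArg _ (Category.comp_id _).symm))
  | succ n ih =>
    cases k with
    | zero =>
      simp only [insertAt]
      exact (congrArg (· ≫ _) (id_whiskerRight _ _)).trans ((Category.id_comp _).trans
        (congrArg _ (Category.comp_id _).symm))
    | succ k =>
      have key {P Q R : C} (i : A ⊗ P ⟶ Q) (s : Q ⊗ A ⟶ R) {P' : C} (s' : P ⊗ A ⟶ P')
          (i' : A ⊗ P' ⟶ R) (h : i ▷ A ≫ s = (α_ A P A).hom ≫ A ◁ s' ≫ i') :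
          ((α_ A A P).inv ≫ (β_ A A).hom ▷ P ≫ (α_ A A P).hom ≫ A ◁ i) ▷ A ≫
            (α_ A Q A).hom ≫ A ◁ s = (α_ A (A ⊗ P) A).hom ≫ A ◁ ((α_ A P A).hom ≫ A ◁ s') ≫
            (α_ A A P').inv ≫ (β_ A A).hom ▷ P' ≫ (α_ A A P').hom ≫ A ◁ i' := by
        have h' := congrArg (fun f => A ◁ f) h
        simp only [whiskerLeft_comp] at h'
        simp only [comp_whiskerRight, Category.assoc, associator_naturality_middle_assoc, h',
          whiskerLeft_comp]
        have e : A ◁ A ◁ s' ≫ (α_ A A P').inv ≫ (β_ A A).hom ▷ P' ≫ (α_ A A P').hom =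
            (α_ A A (P ⊗ A)).inv ≫ (β_ A A).hom ▷ (P ⊗ A) ≫ (α_ A A (P ⊗ A)).hom ≫
              A ◁ A ◁ s' := by
          rw [associator_inv_naturality_right_assoc, whisker_exchange_assoc,
            associator_naturality_right]
        rw [reassoc_of% e]
        simp
      exact key _ _ _ _ (ih k (by omega))

theorem insertAt_self (A : C) (n : ℕ) :
    insertAt A n n = (β_ A (pow A n)).hom ≫ (powSnoc A n).hom := by
  induction n with
  | zero =>
    change 𝟙 (A ⊗ 𝟙_ C) = (β_ A (𝟙_ C)).hom ≫ (λ_ A).hom ≫ (ρ_ A).inv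
    simp
  | succ n ih =>
    have key {P Q : C} (i : A ⊗ P ⟶ Q) (s : P ⊗ A ⟶ Q) (h : i = (β_ A P).hom ≫ s) :
        (α_ A A P).inv ≫ (β_ A A).hom ▷ P ≫ (α_ A A P).hom ≫ A ◁ i =
          (β_ A (A ⊗ P)).hom ≫ (α_ A P A).hom ≫ A ◁ s := by
      simp [h]
    exact key _ _ ih

/-- Rotating sends `x₀` to the end, so the inserted factor slides from position `k + 1` to `k`. Its
crossing with `x₀` is undone by symmetry, and the other factors are rotated among themselves. -/
theorem insertAt_comp_rot {A : C} (L : A ⟶ A) (n k : ℕ) (hk : k ≤ n) :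
    insertAt A (n + 1) (k + 1) ≫ rot L (n + 1) = A ◁ rot L n ≫ insertAt A (n + 1) k := by
  have key {P Q R : C} (i : A ⊗ P ⟶ Q) (s : Q ⊗ A ⟶ R) {P' : C} (s' : P ⊗ A ⟶ P')
      (i' : A ⊗ P' ⟶ R) (h : i ▷ A ≫ s = (α_ A P A).hom ≫ A ◁ s' ≫ i') :
      ((α_ A A P).inv ≫ (β_ A A).hom ▷ P ≫ (α_ A A P).hom ≫ A ◁ i) ≫
        L ▷ Q ≫ (β_ A Q).hom ≫ s =
      A ◁ (L ▷ P ≫ (β_ A P).hom ≫ s') ≫ i' := by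
    simp only [Category.assoc]
    rw [whisker_exchange_assoc, BraidedCategory.braiding_naturality_right_assoc, h,
      BraidedCategory.braiding_tensor_right_hom, ← associator_naturality_left_assoc]
    have e : (β_ A A).hom ▷ P ≫ (L ▷ A) ▷ P ≫ (β_ A A).hom ▷ P = (A ◁ L) ▷ P := by
      simp only [← comp_whiskerRight, BraidedCategory.braiding_naturality_left,
        SymmetricCategory.symmetry_assoc]
    simp only [Category.assoc, Iso.hom_inv_id_assoc, reassoc_of% e, associator_naturality_middle_assoc,
      Iso.inv_hom_id_assoc, whiskerLeft_comp]
  exact key _ _ _ _ (insertAt_whiskerRight_powSnoc A n k hk)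

theorem insertAt_comp_homPow_rot {A : C} (L : A ⟶ A) (n k : ℕ) (hk : k ≤ n + 1) :
    insertAt A (n + 1) k ≫ homPow (rot L (n + 1)) k = A ◁ homPow (rot L n) k := by
  induction k with
  | zero => exact (Category.comp_id _).trans (whiskerLeft_id _ _).symm
  | succ k ih =>
    rw [homPow, homPow, ← Category.assoc, insertAt_comp_rot L n k (by omega), whiskerLeft_comp,
      ← ih (by omega)]
    exact Category.assoc _ _ _

/-- Induction on the number of factors. The first rotation inserts `L a₀` at the end; the remaining
`n + 1` bring it back to the front while the other factors make a full turn, which by induction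
applies `L` to each of them. -/
theorem homPow_rot {A : C} (L : A ⟶ A) (n : ℕ) :
    homPow (rot L n) (n + 1) = powMap L (n + 1) := by
  induction n with
  | zero =>
    change (L ▷ 𝟙_ C ≫ (β_ A (𝟙_ C)).hom ≫ (λ_ A).hom ≫ (ρ_ A).inv) ≫ 𝟙 (A ⊗ 𝟙_ C) =
      L ⊗ₘ 𝟙 (𝟙_ C)
    simp [MonoidalCategory.tensorHom_def]
  | succ n ih =>
    have h := insertAt_comp_homPow_rot L n (n + 1) le_rfl
    rw [insertAt_self, ih] at h
    rw [homPow, rot]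
    have key {P R S : C} (f : A ⊗ P ⟶ R) (s : R ⟶ S) (t : S ⟶ A ⊗ P) (g : P ⟶ P)
        (h : (f ≫ s) ≫ t = A ◁ g) : (L ▷ P ≫ f ≫ s) ≫ t = L ⊗ₘ g := by
      rw [MonoidalCategory.tensorHom_def, ← h]
      simp
    exact key _ _ _ _ h

end Symmetric

end Rotation

/-! ### The paracocyclic identities for twisted rotations -/

section RotationData

variable {C : Type u} [Category.{v} C] [MonoidalCategory C] [SymmetricCategory C]
  {A : C} [ComonObj A]

/-- The faces, degeneracies and rotations on the powers of a coalgebra twisted by `L`. -/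
def rotData (L : A ⟶ A) : CocyclicData C where
  X n := pow A (n + 1)
  δ n := Fin.lastCases (comulAt A (n + 1) 0 ≫ rot L (n + 1))
    (fun i : Fin (n + 1) => comulAt A (n + 1) i)
  σ n i := counitAt A (n + 1) i.succ
  τ n := rot L n

theorem rotData_δ_castSucc (L : A ⟶ A) (n : ℕ) (i : Fin (n + 1)) :
    (rotData L).δ n i.castSucc = comulAt A (n + 1) i := by
  simp only [rotData, Fin.lastCases_castSucc]

theorem rotData_δ_last (L : A ⟶ A) (n : ℕ) :
    (rotData L).δ n (Fin.last (n + 1)) = comulAt A (n + 1) 0 ≫ rot L (n + 1) := by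
  simp only [rotData, Fin.lastCases_last]

theorem rotData_δ_zero (L : A ⟶ A) (n : ℕ) : (rotData L).δ n 0 = comulAt A (n + 1) 0 :=
  rotData_δ_castSucc L n 0

theorem comulAt_succ_comp_rot (L : A ⟶ A) (n : ℕ) (i : Fin n) :
    comulAt A (n + 1) i.succ ≫ rot L (n + 1) = rot L n ≫ comulAt A (n + 1) i.castSucc :=
  whiskerLeft_comp_rot L (comulAt_whiskerRight_powSnoc A n i)

theorem counitAt_succ_comp_rot (L : A ⟶ A) (n : ℕ) (i : Fin (n + 1)) :
    counitAt A (n + 1) i.succ ≫ rot L n = rot L (n + 1) ≫ counitAt A (n + 1) i.castSucc :=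
  whiskerLeft_comp_rot L (counitAt_whiskerRight_powSnoc A n i)

theorem isParacocyclic_rotData {L : A ⟶ A} (hΔ : L ≫ Δ[A] = Δ[A] ≫ (L ⊗ₘ L))
    (hε : L ≫ ε[A] = ε[A]) : (rotData L).IsParacocyclic where
  δ_comp_δ n i j hij := by
    cases j using Fin.lastCases with
    | cast j =>
      cases i using Fin.lastCases with
      | last => exact absurd hij (by simp)
      | cast i =>
        rw [Fin.succ_castSucc]
        simp only [rotData_δ_castSucc]
        exact comulAt_comp_comulAt A (n + 1) i j (by simpa using hij)
    | last =>
      rw [Fin.succ_last, rotData_δ_last, rotData_δ_last, rotData_δ_castSucc]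
      cases i using Fin.lastCases with
      | cast i =>
        rw [rotData_δ_castSucc]
        change comulAt A (n + 1) i ≫ comulAt A (n + 2) 0 ≫ rot L (n + 2) =
          (comulAt A (n + 1) 0 ≫ rot L (n + 1)) ≫ comulAt A (n + 2) i.castSucc
        rw [Category.assoc, ← comulAt_succ_comp_rot, ← Category.assoc,
          ← Category.assoc, comulAt_comp_comulAt A (n + 1) 0 i (Fin.zero_le _)]
        rfl
      -- Two last faces: both composites are a double comultiplication of the head followed by two
      -- rotations, and they agree by coassociativity.
      | last =>
        rw [rotData_δ_last]
        change (comulAt A (n + 1) 0 ≫ rot L (n + 1)) ≫ comulAt A (n + 2) 0 ≫ rot L (n + 2) =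
          (comulAt A (n + 1) 0 ≫ rot L (n + 1)) ≫ comulAt A (n + 2) (Fin.last (n + 1))
        rw [Category.assoc, Category.assoc, ← comulAt_zero_rot_rot hΔ]
        have h := comulAt_succ_comp_rot L (n + 1) 0
        rw [Fin.castSucc_zero] at h
        rw [← reassoc_of% h, ← Category.assoc, comulAt_comp_comulAt A (n + 1) 0 0 le_rfl,
          Category.assoc]
        rfl
  σ_comp_σ n i j hij := counitAt_comp_counitAt A (n + 1) i.succ j.succ (by simpa using hij)
  δ_comp_σ_of_le n i j hij := by
    cases i using Fin.lastCases with
    | last => exact absurd hij (by simp)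
    | cast i =>
      rw [rotData_δ_castSucc, rotData_δ_castSucc]
      exact comulAt_comp_counitAt_of_le A n i j (by simpa using hij)
  δ_comp_σ_self n i := by
    rw [rotData_δ_castSucc]
    exact comulAt_comp_counitAt_succ A (n + 1) i
  δ_comp_σ_succ n i := by
    cases i using Fin.lastCases with
    | last =>
      rw [Fin.succ_last, rotData_δ_last]
      change (comulAt A (n + 1) 0 ≫ rot L (n + 1)) ≫ counitAt A (n + 1) (Fin.last (n + 1)) =
        𝟙 (pow A (n + 1))
      rw [Category.assoc, rot_counitAt_last hε (n + 1)]
      exact comulAt_comp_counitAt_self A (n + 1) 0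
    | cast i =>
      rw [Fin.succ_castSucc, rotData_δ_castSucc]
      exact comulAt_comp_counitAt_self A (n + 1) i.succ
  δ_comp_σ_of_gt n i j hij := by
    change _ ≫ counitAt A (n + 2) j.succ.castSucc = counitAt A (n + 1) j.succ ≫ _
    cases i using Fin.lastCases with
    | last =>
      rw [Fin.succ_last, rotData_δ_last, rotData_δ_last]
      change (comulAt A (n + 2) 0 ≫ rot L (n + 2)) ≫ counitAt A (n + 2) j.succ.castSucc =
        counitAt A (n + 1) j.succ ≫ comulAt A (n + 1) 0 ≫ rot L (n + 1)
      rw [Category.assoc, ← counitAt_succ_comp_rot,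
        ← Category.assoc, ← Category.assoc,
        ← comulAt_comp_counitAt_of_le A n 0 j (Fin.zero_le _)]
      rfl
    | cast i =>
      rw [Fin.succ_castSucc, rotData_δ_castSucc, rotData_δ_castSucc]
      exact comulAt_comp_counitAt_of_gt A (n + 1) i j.succ
        (Fin.succ_le_castSucc_iff.2 (Fin.castSucc_lt_castSucc_iff.1 hij))
  δ_succ_comp_τ n i := by
    rw [rotData_δ_castSucc]
    cases i using Fin.lastCases with
    | last =>
      rw [Fin.succ_last, rotData_δ_last]
      refine (Category.assoc (comulAt A (n + 1) 0) (rot L (n + 1)) (rot L (n + 1))).trans ?_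
      exact comulAt_zero_rot_rot hΔ n
    | cast i =>
      rw [Fin.succ_castSucc, rotData_δ_castSucc]
      exact comulAt_succ_comp_rot L n i
  δ_zero_comp_τ n := by rw [rotData_δ_zero, rotData_δ_last]; rfl
  σ_succ_comp_τ n i := counitAt_succ_comp_rot L n i.succ
  σ_zero_comp_τ n := by
    refine (counitAt_succ_comp_rot L n 0).trans ?_
    exact congrArg (rot L (n + 1) ≫ ·) (rot_counitAt_last hε (n + 1)).symm

end RotationData

/-! ### Multiplication by elements of an algebra -/

section Multiplication

variable {C : Type u} [Category.{v} C] [MonoidalCategory C]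

/-- Left multiplication by an element of a monoid. -/
def lmul {Z : C} [MonObj Z] (a : 𝟙_ C ⟶ Z) : Z ⟶ Z := (λ_ Z).inv ≫ a ▷ Z ≫ μ[Z]

/-- Right multiplication by an element of a monoid. -/
def rmul {Z : C} [MonObj Z] (a : 𝟙_ C ⟶ Z) : Z ⟶ Z := (ρ_ Z).inv ≫ Z ◁ a ≫ μ[Z]

variable {Z W : C} [MonObj Z] [MonObj W]

theorem mul_lmul (a : 𝟙_ C ⟶ Z) : μ[Z] ≫ lmul a = lmul a ▷ Z ≫ μ[Z] := by
  rw [lmul, leftUnitor_inv_naturality_assoc, whisker_exchange_assoc, MonObj.mul_assoc_flip]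
  simp

theorem mul_rmul (a : 𝟙_ C ⟶ Z) : μ[Z] ≫ rmul a = Z ◁ rmul a ≫ μ[Z] := by
  rw [rmul, rightUnitor_inv_naturality_assoc, ← whisker_exchange_assoc, MonObj.mul_assoc]
  simp

theorem lmul_one : lmul η[Z] = 𝟙 Z := by simp [lmul]

theorem one_lmul (a : 𝟙_ C ⟶ Z) : η[Z] ≫ lmul a = a := by
  rw [lmul, leftUnitor_inv_naturality_assoc, whisker_exchange_assoc, MonObj.mul_one,
    rightUnitor_naturality, unitors_inv_equal, Iso.inv_hom_id_assoc]

theorem one_rmul (a : 𝟙_ C ⟶ Z) : η[Z] ≫ rmul a = a := by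
  rw [rmul, rightUnitor_inv_naturality_assoc, ← whisker_exchange_assoc, MonObj.one_mul,
    leftUnitor_naturality, ← unitors_inv_equal, Iso.inv_hom_id_assoc]

theorem lmul_comp_lmul (a b : 𝟙_ C ⟶ Z) :
    lmul a ≫ lmul b = lmul ((λ_ (𝟙_ C)).inv ≫ (b ⊗ₘ a) ≫ μ[Z]) := by
  conv_lhs => rw [lmul]
  rw [Category.assoc, Category.assoc, mul_lmul, ← comp_whiskerRight_assoc]
  conv_lhs => rw [lmul, leftUnitor_inv_naturality_assoc, whisker_exchange_assoc,
    ← MonoidalCategory.tensorHom_def_assoc]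
  rfl

theorem lmul_comp_rmul (a b : 𝟙_ C ⟶ Z) : lmul a ≫ rmul b = rmul b ≫ lmul a := by
  conv_lhs => rw [lmul]
  rw [Category.assoc, Category.assoc, mul_rmul, ← whisker_exchange_assoc,
    ← leftUnitor_inv_naturality_assoc]
  rfl

theorem lmul_comp_hom (a : 𝟙_ C ⟶ Z) (f : Z ⟶ W) [IsMonHom f] :
    lmul a ≫ f = f ≫ lmul (a ≫ f) := by
  rw [lmul, lmul, leftUnitor_inv_naturality_assoc, whisker_exchange_assoc, Category.assoc,
    Category.assoc, IsMonHom.mul_hom, MonoidalCategory.tensorHom_def, Category.assoc,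
    comp_whiskerRight_assoc]

instance : IsMonHom η[Z] where
  mul_hom := by
    rw [MonoidalCategory.tensorHom_def', Category.assoc, MonObj.one_mul, leftUnitor_naturality]
    rfl

/-- `z ↦ z ⊗ 1`. -/
def inlOne (Z W : C) [MonObj W] : Z ⟶ Z ⊗ W := (ρ_ Z).inv ≫ Z ◁ η[W]

/-- `w ↦ 1 ⊗ w`. -/
def inrOne (Z W : C) [MonObj Z] : W ⟶ Z ⊗ W := (λ_ W).inv ≫ η[Z] ▷ W

theorem inrOne_comp_whiskerLeft {W W' : C} (f : W ⟶ W') :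
    inrOne Z W ≫ Z ◁ f = f ≫ inrOne Z W' := by
  rw [inrOne, inrOne, Category.assoc, ← whisker_exchange, leftUnitor_inv_naturality_assoc]

variable [BraidedCategory C]

theorem lmul_tensor (a : 𝟙_ C ⟶ Z) (b : 𝟙_ C ⟶ W) :
    lmul ((λ_ (𝟙_ C)).inv ≫ (a ⊗ₘ b)) = lmul a ⊗ₘ lmul b := by
  have h : (λ_ (𝟙_ C)).inv ▷ (Z ⊗ W) ≫ tensorμ (𝟙_ C) (𝟙_ C) Z W =
      (λ_ (Z ⊗ W)).hom ≫ ((λ_ Z).inv ⊗ₘ (λ_ W).inv) := by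
    rw [tensor_left_unitality]
    simp
  simp only [lmul, MonObj.tensorObj.mul_def, comp_whiskerRight, Category.assoc]
  rw [tensorμ_natural_left_assoc, reassoc_of% h]
  simp

instance : IsMonHom (inrOne Z W) :=
  inferInstanceAs (IsMonHom ((λ_ W).inv ≫ η[Z] ▷ W))

theorem inlOne_inrOne_mul : (inlOne Z W ⊗ₘ inrOne Z W) ≫ μ[Z ⊗ W] = 𝟙 (Z ⊗ W) := by
  have h := tensorμ_natural (𝟙 Z) η[W] η[Z] (𝟙 W)
  simp only [id_tensorHom, tensorHom_id] at h
  rw [inlOne, inrOne, MonObj.tensorObj.mul_def, ← tensorHom_comp_tensorHom, Category.assoc,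
    reassoc_of% h, tensorHom_comp_tensorHom, MonObj.mul_one, MonObj.one_mul]
  rw [tensorμ, braiding_tensorUnit_left]
  monoidal

theorem lmul_inrOne (b : 𝟙_ C ⟶ W) : lmul (b ≫ inrOne Z W) = Z ◁ lmul b := by
  rw [← id_tensorHom, ← lmul_one, ← lmul_tensor, inrOne, leftUnitor_inv_naturality_assoc,
    whisker_exchange, ← MonoidalCategory.tensorHom_def]

end Multiplication

/-! ### Equality of actions after a quotient map -/

section ActEq

variable {C : Type u} [Category.{v} C] [MonoidalCategory C]

/-- The actions through `u` and `v` by left multiplication become equal after `q`. -/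
def ActEq {W Z B : C} [MonObj Z] (q : Z ⟶ B) (u v : W ⟶ Z) : Prop :=
  u ▷ Z ≫ μ[Z] ≫ q = v ▷ Z ≫ μ[Z] ≫ q

variable {X Y W Z Z' B : C} [MonObj Z] [MonObj Z']

theorem ActEq.precomp {q : Z ⟶ B} {u v : W ⟶ Z} (h : ActEq q u v) (w : X ⟶ W) :
    ActEq q (w ≫ u) (w ≫ v) := by
  simp only [ActEq, comp_whiskerRight, Category.assoc] at h ⊢
  rw [h]

/-- Associativity turns `(u w) z` into `u (w z)`, so the relation survives multiplication of the
acting elements on the right. -/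
theorem ActEq.mul {q : Z ⟶ B} {u v : X ⟶ Z} (h : ActEq q u v) (d : W ⟶ X ⊗ Y) (w : Y ⟶ Z) :
    ActEq q (d ≫ (u ⊗ₘ w) ≫ μ[Z]) (d ≫ (v ⊗ₘ w) ≫ μ[Z]) := by
  have key (u : X ⟶ Z) : (d ≫ (u ⊗ₘ w) ≫ μ[Z]) ▷ Z ≫ μ[Z] ≫ q =
      d ▷ Z ≫ (α_ X Y Z).hom ≫ X ◁ (w ▷ Z ≫ μ[Z]) ≫ u ▷ Z ≫ μ[Z] ≫ q := by
    rw [whisker_exchange_assoc, MonoidalCategory.tensorHom_def]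
    simp
  rw [ActEq, key, key, h]

theorem ActEq.of_comp_hom {f : Z ⟶ Z'} [IsMonHom f] {q : Z' ⟶ B} {u v : W ⟶ Z}
    (h : ActEq q (u ≫ f) (v ≫ f)) : ActEq (f ≫ q) u v := by
  have key (u : W ⟶ Z) : u ▷ Z ≫ μ[Z] ≫ f ≫ q = W ◁ f ≫ (u ≫ f) ▷ Z' ≫ μ[Z'] ≫ q := by
    rw [IsMonHom.mul_hom_assoc, MonoidalCategory.tensorHom_def, whisker_exchange_assoc]
    simp
  rw [ActEq, key, key, h]

/-- Left multiplication by `a` is not an algebra map, but `a (u z) = (a u) z` suffices. -/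
theorem ActEq.of_lmul {a : 𝟙_ C ⟶ Z} {q : Z ⟶ B} {u v : W ⟶ Z}
    (h : ActEq q (u ≫ lmul a) (v ≫ lmul a)) : ActEq (lmul a ≫ q) u v := by
  simp only [ActEq, comp_whiskerRight, Category.assoc, ← reassoc_of% (mul_lmul a)] at h ⊢
  exact h

end ActEq

/-! ### Convolution -/

section Convolution

variable {C : Type u} [Category.{v} C] [MonoidalCategory C] {H Z W : C} [ComonObj H] [MonObj Z]
  [MonObj W]

/-- The convolution product. -/
def conv (f g : H ⟶ Z) : H ⟶ Z := Δ[H] ≫ (f ⊗ₘ g) ≫ μ[Z]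

theorem conv_eq_mul (f g : H ⟶ Z) : conv f g = (show Conv H Z from f) * (show Conv H Z from g) := by
  rw [conv, Conv.mul_eq, MonoidalCategory.tensorHom_def, Category.assoc]

theorem conv_assoc (f g k : H ⟶ Z) : conv (conv f g) k = conv f (conv g k) := by
  rw [conv_eq_mul (conv f g), conv_eq_mul f g, conv_eq_mul f, conv_eq_mul g k]
  exact mul_assoc (G := Conv H Z) f g k

theorem conv_counit (f : H ⟶ Z) : conv f (ε[H] ≫ η[Z]) = f := by
  rw [conv_eq_mul]
  exact mul_one (M := Conv H Z) f

theorem conv_comp (f g : H ⟶ Z) (φ : Z ⟶ W) [IsMonHom φ] :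
    conv f g ≫ φ = conv (f ≫ φ) (g ≫ φ) := by
  simp [conv]

theorem scalar_conv (δ : H ⟶ 𝟙_ C) (f : H ⟶ Z) :
    conv (δ ≫ η[Z]) f = Δ[H] ≫ (δ ⊗ₘ f) ≫ (λ_ Z).hom := by
  rw [conv, ← MonObj.one_mul]
  simp [MonoidalCategory.tensorHom_def']

theorem ActEq.conv {B : C} {q : Z ⟶ B} {u v : H ⟶ Z} (h : ActEq q u v) (w : H ⟶ Z) :
    ActEq q (conv u w) (conv v w) :=
  h.mul Δ[H] w

end Convolution

/-! ### The twisted antipode and the modular pair -/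

section Hopf

variable {C : Type u} [Category.{v} C] [MonoidalCategory C] [BraidedCategory C] {H : C} [HopfObj H]

instance : IsMonHom Δ[H] where
  one_hom := BimonObj.one_comul H
  mul_hom := BimonObj.mul_comul H

instance : IsMonHom ε[H] where
  one_hom := BimonObj.one_counit H
  mul_hom := Bimon.mul_counit H

variable {δ : H ⟶ 𝟙_ C}

theorem twistedAntipode_eq_conv (δ : H ⟶ 𝟙_ C) : twistedAntipode δ = conv (δ ≫ η[H]) 𝒮[H] :=
  (scalar_conv δ 𝒮[H]).symm

/-- In the convolution algebra `S̃ = δ * S` and `S * id` is the unit. -/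
theorem twistedAntipode_conv_id (δ : H ⟶ 𝟙_ C) : conv (twistedAntipode δ) (𝟙 H) = δ ≫ η[H] := by
  rw [twistedAntipode_eq_conv, conv_assoc]
  have h : conv 𝒮[H] (𝟙 H) = ε[H] ≫ η[H] := by
    rw [conv, tensorHom_id, HopfObj.antipode_left]
  rw [h, conv_counit]

theorem one_twistedAntipode (hδ : IsCharacter δ) : η[H] ≫ twistedAntipode δ = η[H] := by
  rw [twistedAntipode, Bimon.one_comul_assoc, tensorHom_comp_tensorHom_assoc, hδ.one,
    HopfObj.one_antipode, id_tensorHom, leftUnitor_naturality, Iso.inv_hom_id_assoc]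

theorem mul_twistedAntipode (hδ : IsCharacter δ) :
    μ[H] ≫ twistedAntipode δ =
      (twistedAntipode δ ⊗ₘ twistedAntipode δ) ≫ (β_ H H).hom ≫ μ[H] := by
  have h := leftUnitor_monoidal (C := C) H H
  rw [twistedAntipode, BimonObj.mul_comul_assoc, tensorHom_comp_tensorHom_assoc, hδ.mul,
    HopfObj.mul_antipode, ← tensorHom_comp_tensorHom_assoc, ← tensorμ_natural_assoc,
    tensorHom_comp_tensorHom_assoc]
  simp only [← tensorHom_comp_tensorHom, Category.assoc]
  rw [h]
  simp [MonoidalCategory.tensorHom_def]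

variable {σ : 𝟙_ C ⟶ H}

theorem lmul_cocharacter_comul (hσ : IsCocharacter σ) :
    lmul σ ≫ Δ[H] = Δ[H] ≫ (lmul σ ⊗ₘ lmul σ) := by
  rw [lmul_comp_hom, hσ.comul, lmul_tensor]

theorem lmul_cocharacter_counit (hσ : IsCocharacter σ) : lmul σ ≫ ε[H] = ε[H] := by
  rw [lmul_comp_hom, hσ.counit]
  exact (congrArg (ε[H] ≫ ·) (lmul_one (Z := 𝟙_ C))).trans (Category.comp_id _)

/-- A co-character is convolution inverted by the antipode: `σ S(σ) = 1`. -/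
theorem lmul_antipode_comp_lmul (hσ : IsCocharacter σ) :
    lmul (σ ≫ 𝒮[H]) ≫ lmul σ = 𝟙 H := by
  have h : (λ_ (𝟙_ C)).inv ≫ (σ ⊗ₘ σ ≫ 𝒮[H]) ≫ μ[H] = η[H] := by
    have h' : (σ ⊗ₘ σ ≫ 𝒮[H]) = (σ ⊗ₘ σ) ≫ H ◁ 𝒮[H] := by
      simp [MonoidalCategory.tensorHom_def]
    rw [h', Category.assoc, ← reassoc_of% hσ.comul, HopfObj.antipode_right,
      ← Category.assoc, hσ.counit, Category.id_comp]
  rw [lmul_comp_lmul, h, lmul_one]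

/-- Multiplying the involution axiom `S(σ) S̃²(h) σ = h` on the left by `σ` and using `σ S(σ) = 1`
gives `σ h = S̃²(h) σ`. -/
theorem IsBraidedMPI.lmul_eq (h : IsBraidedMPI δ σ) :
    lmul σ = (twistedAntipode δ ≫ twistedAntipode δ) ≫ rmul σ := by
  have hi : (twistedAntipode δ ≫ twistedAntipode δ) ≫ lmul (σ ≫ 𝒮[H]) ≫ rmul σ = 𝟙 H := by
    rw [← h.involution, lmul, rmul]
    generalize twistedAntipode δ ≫ twistedAntipode δ = s
    generalize σ ≫ 𝒮[H] = a
    rw [Category.assoc, Category.assoc, leftUnitor_inv_naturality_assoc,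
      ← MonoidalCategory.tensorHom_def'_assoc, rightUnitor_inv_naturality_assoc,
      rightUnitor_inv_naturality_assoc, MonoidalCategory.tensorHom_def (a ⊗ₘ s), Category.assoc,
      whisker_exchange_assoc]
  have := hi =≫ lmul σ
  rw [Category.id_comp, Category.assoc, Category.assoc, Category.assoc, ← lmul_comp_rmul,
    ← Category.assoc (lmul _), lmul_antipode_comp_lmul h.cocharacter, Category.id_comp] at this
  rw [← this, Category.assoc]

/-- `S̃(h₂) σ h₁ = δ(h) σ`. -/
theorem IsBraidedMPI.comul_braiding_twistedAntipode_lmul (h : IsBraidedMPI δ σ) :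
    Δ[H] ≫ (β_ H H).hom ≫ (twistedAntipode δ ⊗ₘ lmul σ) ≫ μ[H] = δ ≫ σ := by
  -- The computation is `S̃(h₂) σ h₁ = S̃(h₂) S̃²(h₁) σ = S̃(S̃(h₁) h₂) σ = δ(h) S̃(1) σ = δ(h) σ`.
  have e : (twistedAntipode δ ⊗ₘ lmul σ) ≫ μ[H] =
      (twistedAntipode δ ⊗ₘ (twistedAntipode δ ≫ twistedAntipode δ)) ≫ μ[H] ≫ rmul σ := by
    rw [h.lmul_eq, mul_rmul]
    simp [MonoidalCategory.tensorHom_def]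
  have e' : (β_ H H).hom ≫ (twistedAntipode δ ⊗ₘ (twistedAntipode δ ≫ twistedAntipode δ)) =
      twistedAntipode δ ▷ H ≫ (twistedAntipode δ ⊗ₘ twistedAntipode δ) ≫ (β_ H H).hom := by
    rw [← BraidedCategory.braiding_naturality]
    simp [MonoidalCategory.tensorHom_def]
  rw [e, reassoc_of% e', ← reassoc_of% (mul_twistedAntipode h.character)]
  have k := twistedAntipode_conv_id δ
  rw [conv, tensorHom_id] at k
  rw [reassoc_of% k, reassoc_of% (one_twistedAntipode h.character), one_rmul]

end Hopf

/-! ### Moving the action across a balanced tensor product -/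

section Swap

variable {C : Type u} [Category.{v} C] [MonoidalCategory C] [BraidedCategory C] {H : C} [HopfObj H]
  {X Y B : C} [MonObj X] [MonObj Y] {δ : H ⟶ 𝟙_ C}

/-- In a balanced quotient, `h x ⊗ y = x ⊗ S̃(h) y`. -/
theorem ActEq.swap {f : H ⟶ X} {g : H ⟶ Y} [IsMonHom g] {q : X ⊗ Y ⟶ B}
    (h : ActEq q (Δ[H] ≫ (f ⊗ₘ g)) (δ ≫ η[X ⊗ Y])) :
    ActEq q (f ≫ inlOne X Y) (twistedAntipode δ ≫ g ≫ inrOne X Y) := by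
  have h1 : Δ[H] ≫ (f ⊗ₘ g) = BraidedHopfCyclic.conv (f ≫ inlOne X Y) (g ≫ inrOne X Y) := by
    rw [BraidedHopfCyclic.conv, ← tensorHom_comp_tensorHom_assoc, inlOne_inrOne_mul,
      Category.comp_id]
  have h2 : BraidedHopfCyclic.conv (g ≫ inrOne X Y) (𝒮[H] ≫ g ≫ inrOne X Y) =
      ε[H] ≫ η[X ⊗ Y] := by
    have := conv_comp (𝟙 H) 𝒮[H] (g ≫ inrOne X Y)
    rw [Category.id_comp] at this
    rw [← this, BraidedHopfCyclic.conv, id_tensorHom, HopfObj.antipode_right, Category.assoc,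
      IsMonHom.one_hom]
  -- Convolving on the right with `1 ⊗ g(S(h))` cancels the second leg on the left side and produces
  -- `S̃ = δ * S` on the right.
  have h3 := h.conv (𝒮[H] ≫ g ≫ inrOne X Y)
  rw [h1, conv_assoc, h2, conv_counit] at h3
  rw [twistedAntipode_eq_conv, conv_comp, Category.assoc, IsMonHom.one_hom]
  exact h3

end Swap

/-! ### The retraction of the balanced quotient, and descent of the rotation -/

section Retraction

variable {C : Type u} [Category.{v} C] [MonoidalCategory C]

section Braided

variable [BraidedCategory C] {H P : C} [HopfObj H] [MonObj P]

/-- `a ⊗ b ⊗ h ⊗ x ↦ (h a) (b x) = h (a b) x`. -/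
theorem tensorμ_braiding_mul (P : C) [MonObj P] :
    tensorμ P P P P ≫ (((β_ P P).hom ≫ μ[P]) ⊗ₘ μ[P]) ≫ μ[P] =
      (α_ (P ⊗ P) P P).inv ≫ (μ[P] ▷ P ≫ (β_ P P).hom ≫ μ[P]) ▷ P ≫ μ[P] := by
  have h : μ[P] ▷ P ▷ P ≫ (α_ P P P).hom ≫ P ◁ μ[P] ≫ μ[P] =
      (α_ P P P).hom ▷ P ≫ (α_ P (P ⊗ P) P).hom ≫ P ◁ μ[P] ▷ P ≫ P ◁ μ[P] ≫ μ[P] := by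
    rw [associator_naturality_left_assoc, ← whisker_exchange_assoc, MonObj.mul_assoc,
      ← whiskerLeft_comp_assoc P (μ[P] ▷ P), MonObj.mul_assoc]
    simp
  rw [BraidedCategory.braiding_naturality_left_assoc, BraidedCategory.braiding_tensor_left_hom]
  simp [tensorμ, MonoidalCategory.tensorHom_def, h]

theorem one_whiskerRight_braiding_mul (P : C) [MonObj P] :
    η[P] ▷ P ≫ (β_ P P).hom ≫ μ[P] = (λ_ P).hom := by
  rw [BraidedCategory.braiding_naturality_left_assoc, MonObj.mul_one]
  simp

/-- `h ⊗ x ↦ S̃(h) x`, where `H` acts through `d`. -/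
def retraction (δ : H ⟶ 𝟙_ C) (d : H ⟶ P) : H ⊗ P ⟶ P := (twistedAntipode δ ≫ d) ▷ P ≫ μ[P]

variable {δ : H ⟶ 𝟙_ C} (d : H ⟶ P) [IsMonHom d]

theorem inrOne_retraction (hδ : IsCharacter δ) : inrOne H P ≫ retraction δ d = 𝟙 P := by
  rw [inrOne, retraction, Category.assoc, ← comp_whiskerRight_assoc,
    reassoc_of% (one_twistedAntipode hδ), IsMonHom.one_hom, MonObj.one_mul, Iso.inv_hom_id]

/-- Antimultiplicativity gives `S̃(h₁ a) h₂ b = S̃(a) S̃(h₁) h₂ b = δ(h) S̃(a) b`. -/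
theorem actEq_retraction (hδ : IsCharacter δ) :
    ActEq (retraction δ d) (Δ[H] ≫ H ◁ d) (δ ≫ η[H ⊗ P]) := by
  have h1 : μ[H] ≫ twistedAntipode δ ≫ d =
      ((twistedAntipode δ ≫ d) ⊗ₘ (twistedAntipode δ ≫ d)) ≫ (β_ P P).hom ≫ μ[P] := by
    rw [reassoc_of% (mul_twistedAntipode hδ), IsMonHom.mul_hom,
      ← BraidedCategory.braiding_naturality_assoc]
    simp
  have h2 : Δ[H] ≫ ((twistedAntipode δ ≫ d) ⊗ₘ d) ≫ μ[P] = δ ≫ η[P] := by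
    have := conv_comp (twistedAntipode δ) (𝟙 H) d
    rw [Category.id_comp, twistedAntipode_conv_id, Category.assoc, IsMonHom.one_hom] at this
    exact this.symm
  rw [ActEq, comp_whiskerRight δ, Category.assoc, MonObj.one_mul_assoc]
  generalize hφ : twistedAntipode δ ≫ d = φ at h1 h2
  rw [retraction, hφ, MonObj.tensorObj.mul_def]
  have e1 : (μ[H] ⊗ₘ μ[P]) ≫ φ ▷ P ≫ μ[P] =
      ((φ ⊗ₘ φ) ⊗ₘ 𝟙 (P ⊗ P)) ≫ (((β_ P P).hom ≫ μ[P]) ⊗ₘ μ[P]) ≫ μ[P] := by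
    rw [tensorHom_comp_tensorHom_assoc, ← h1, Category.id_comp, ← tensorHom_id,
      tensorHom_comp_tensorHom_assoc, Category.comp_id]
  have e2 : tensorμ H P H P ≫ ((φ ⊗ₘ φ) ⊗ₘ 𝟙 (P ⊗ P)) =
      ((φ ⊗ₘ 𝟙 P) ⊗ₘ (φ ⊗ₘ 𝟙 P)) ≫ tensorμ P P P P := by
    rw [tensorμ_natural, id_tensorHom_id]
  have e3 : (Δ[H] ≫ H ◁ d) ▷ (H ⊗ P) ≫ ((φ ⊗ₘ 𝟙 P) ⊗ₘ (φ ⊗ₘ 𝟙 P)) =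
      (H ◁ φ ▷ P) ≫ (Δ[H] ≫ (φ ⊗ₘ d)) ▷ (P ⊗ P) := by
    rw [whisker_exchange, MonoidalCategory.tensorHom_def (φ ⊗ₘ 𝟙 P), ← comp_whiskerRight_assoc]
    simp [MonoidalCategory.tensorHom_def']
  have e4 : (Δ[H] ≫ (φ ⊗ₘ d)) ▷ (P ⊗ P) ≫ (α_ (P ⊗ P) P P).inv ≫
      (μ[P] ▷ P ≫ (β_ P P).hom ≫ μ[P]) ▷ P = δ ▷ (P ⊗ P) ≫ (λ_ (P ⊗ P)).hom := by
    rw [associator_inv_naturality_left_assoc, ← comp_whiskerRight, ← comp_whiskerRight_assoc,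
      Category.assoc, h2, comp_whiskerRight δ, Category.assoc,
      one_whiskerRight_braiding_mul]
    simp
  rw [Category.assoc, e1, reassoc_of% e2, tensorμ_braiding_mul, reassoc_of% e3, reassoc_of% e4,
    whisker_exchange_assoc, leftUnitor_naturality_assoc]

/-- Every map that coequalizes the action with the character factors through the retraction. -/
theorem retraction_inrOne_comp {B : C} {q : H ⊗ P ⟶ B}
    (h : ActEq q (Δ[H] ≫ H ◁ d) (δ ≫ η[H ⊗ P])) : retraction δ d ≫ inrOne H P ≫ q = q := by
  rw [← id_tensorHom] at h
  -- Evaluating the swap relation on `1 ⊗ x` gives `q(h ⊗ x) = q(1 ⊗ S̃(h) x)`.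
  have h1 : H ◁ inrOne H P ≫ _ = H ◁ inrOne H P ≫ _ := congrArg (H ◁ inrOne H P ≫ ·) h.swap
  rw [whisker_exchange_assoc, whisker_exchange_assoc, ← MonoidalCategory.tensorHom_def_assoc,
    ← MonoidalCategory.tensorHom_def_assoc, Category.id_comp, reassoc_of% inlOne_inrOne_mul] at h1
  conv_rhs => rw [h1]
  rw [retraction, ← Category.assoc (twistedAntipode δ), Category.assoc, IsMonHom.mul_hom_assoc,
    ← tensorHom_id, tensorHom_comp_tensorHom_assoc, Category.id_comp]

end Braided

section Symmetric

variable [SymmetricCategory C] {H P B : C} [HopfObj H] [MonObj P] {δ : H ⟶ 𝟙_ C} {σ : 𝟙_ C ⟶ H}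

/-- The rotated action sends `a ⊗ p` to `d(h₂) p ⊗ σ h₁ a`. After `q`, `d(h₂)` moves to the second
factor as `S̃(h₂)`, and `S̃(h₂) σ h₁ = δ(h) σ`. -/
theorem actEq_rotation (h : IsBraidedMPI δ σ) (d : H ⟶ P) {q : P ⊗ H ⟶ B}
    (hq : ActEq q (Δ[H] ≫ d ▷ H) (δ ≫ η[P ⊗ H])) :
    ActEq (lmul σ ▷ P ≫ (β_ H P).hom ≫ q) (Δ[H] ≫ H ◁ d) (δ ≫ η[H ⊗ P]) := by
  rw [BraidedCategory.braiding_naturality_left_assoc]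
  refine ActEq.of_comp_hom ?_
  rw [← lmul_inrOne]
  refine ActEq.of_lmul ?_
  rw [lmul_inrOne]
  rw [← tensorHom_id] at hq
  -- The swap is applied to `h₂`, with `1 ⊗ σ h₁` multiplied on the right.
  have h1 := hq.swap.mul (Δ[H] ≫ (β_ H H).hom) (lmul σ ≫ inrOne P H)
  have e1 : (Δ[H] ≫ H ◁ d) ≫ (β_ H P).hom ≫ P ◁ lmul σ =
      (Δ[H] ≫ (β_ H H).hom) ≫ (d ≫ inlOne P H ⊗ₘ lmul σ ≫ inrOne P H) ≫ μ[P ⊗ H] := by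
    rw [← tensorHom_comp_tensorHom_assoc, inlOne_inrOne_mul]
    simp [MonoidalCategory.tensorHom_def]
  have e2 : (Δ[H] ≫ (β_ H H).hom) ≫
      (twistedAntipode δ ≫ 𝟙 H ≫ inrOne P H ⊗ₘ lmul σ ≫ inrOne P H) ≫ μ[P ⊗ H] =
      (δ ≫ η[H ⊗ P]) ≫ (β_ H P).hom ≫ P ◁ lmul σ := by
    rw [Category.id_comp, ← tensorHom_comp_tensorHom_assoc, ← IsMonHom.mul_hom, Category.assoc,
      Category.assoc, IsMonHom.one_hom_assoc]
    rw [reassoc_of% h.comul_braiding_twistedAntipode_lmul, ← IsMonHom.one_hom (inrOne P H),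
      Category.assoc, inrOne_comp_whiskerLeft, reassoc_of% (one_lmul σ)]
  rw [← e1, e2] at h1
  simpa only [Category.assoc] using h1

end Symmetric

end Retraction

/-! ### Tensor powers of the Hopf algebra -/

section Powers

variable {C : Type u} [Category.{v} C] [MonoidalCategory C]

theorem snocMap_succ {H : C} (σ : 𝟙_ C ⟶ H) (n : ℕ) : snocMap σ (n + 1) = H ◁ snocMap σ n := by
  have key {P Q : C} (s : P ⊗ H ⟶ Q) :
      (ρ_ (H ⊗ P)).inv ≫ (H ⊗ P) ◁ σ ≫ (α_ H P H).hom ≫ H ◁ s =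
        H ◁ ((ρ_ P).inv ≫ P ◁ σ ≫ s) := by
    simp
  exact key _

section Braided

variable [BraidedCategory C]

/-- The tensor powers of an algebra are algebras. -/
@[reducible] def powMonObj (H : C) [MonObj H] : (n : ℕ) → MonObj (pow H n)
  | 0 => inferInstanceAs (MonObj (𝟙_ C))
  | n + 1 =>
    letI := powMonObj H n
    inferInstanceAs (MonObj (H ⊗ pow H n))

instance (H : C) [MonObj H] (n : ℕ) : MonObj (pow H n) := powMonObj H n

theorem mulPow_eq_mul (H : C) [MonObj H] (n : ℕ) : mulPow H n = μ[pow H n] := by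
  induction n with
  | zero => exact Category.comp_id _
  | succ n ih =>
    have key {P Q : C} [MonObj P] (i : P ⊗ P ⟶ Q) (s : Q ⟶ P) (h : i ≫ s = μ[P]) :
        (tensorμ H P H P ≫ (H ⊗ H) ◁ i) ≫ (μ[H] ⊗ₘ s) = μ[H ⊗ P] := by
      rw [MonObj.tensorObj.mul_def, ← h, Category.assoc, ← id_tensorHom,
        tensorHom_comp_tensorHom, Category.id_comp]
    exact key _ _ ih

variable (H : C) [HopfObj H]

/-- The iterated comultiplication `H ⟶ H^{⊗ n}`, with the counit for `n = 0`. -/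
def diagPow : (n : ℕ) → (H ⟶ pow H n)
  | 0 => ε[H]
  | n + 1 => Δ[H] ≫ H ◁ diagPow n

theorem comulPow_eq_diagPow (n : ℕ) : comulPow H n = diagPow H (n + 1) := by
  induction n with
  | zero => exact (ComonObj.comul_counit H).symm
  | succ n ih => rw [comulPow, ih]; rfl

instance isMonHom_diagPow (n : ℕ) : IsMonHom (diagPow H n) := by
  induction n with
  | zero => exact inferInstanceAs (IsMonHom ε[H])
  | succ n ih => exact inferInstanceAs (IsMonHom (Δ[H] ≫ H ◁ diagPow H n))

instance isMonHom_comulAt (n : ℕ) (i : Fin n) : IsMonHom (comulAt H n i) := by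
  induction n with
  | zero => exact i.elim0
  | succ n ih =>
    cases i using Fin.cases with
    | zero => exact inferInstanceAs (IsMonHom (Δ[H] ▷ pow H n ≫ (α_ H H (pow H n)).hom))
    | succ i =>
      have := ih i
      exact inferInstanceAs (IsMonHom (H ◁ comulAt H n i))

instance isMonHom_counitAt (n : ℕ) (i : Fin (n + 1)) : IsMonHom (counitAt H n i) := by
  induction n with
  | zero =>
    obtain rfl := Fin.fin_one_eq_zero i
    exact inferInstanceAs (IsMonHom (ε[H] ▷ 𝟙_ C ≫ (λ_ (𝟙_ C)).hom))
  | succ n ih =>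
    cases i using Fin.cases with
    | zero => exact inferInstanceAs (IsMonHom (ε[H] ▷ pow H (n + 1) ≫ (λ_ (pow H (n + 1))).hom))
    | succ i =>
      have := ih i
      exact inferInstanceAs (IsMonHom (H ◁ counitAt H n i))

instance isMonHom_powSnoc (n : ℕ) : IsMonHom (powSnoc H n).hom := by
  induction n with
  | zero => exact inferInstanceAs (IsMonHom ((λ_ H).hom ≫ (ρ_ H).inv))
  | succ n ih =>
    exact inferInstanceAs (IsMonHom ((α_ H (pow H n) H).hom ≫ H ◁ (powSnoc H n).hom))

theorem diagPow_comulAt (n : ℕ) (i : Fin n) :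
    diagPow H n ≫ comulAt H n i = diagPow H (n + 1) := by
  induction n with
  | zero => exact i.elim0
  | succ n ih =>
    cases i using Fin.cases with
    | zero =>
      have key {P : C} (d : H ⟶ P) :
          (Δ[H] ≫ H ◁ d) ≫ comulHead H P = Δ[H] ≫ H ◁ (Δ[H] ≫ H ◁ d) := by
        rw [Category.assoc, comulHead_naturality, comulHead, whiskerLeft_comp,
          ComonObj.comul_assoc_assoc, Category.assoc]
      exact key _
    | succ i =>
      have key {P Q : C} (d : H ⟶ P) (f : P ⟶ Q) (g : H ⟶ Q) (h : d ≫ f = g) :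
          (Δ[H] ≫ H ◁ d) ≫ H ◁ f = Δ[H] ≫ H ◁ g := by
        rw [← h, whiskerLeft_comp, Category.assoc]
      exact key _ _ _ (ih i)

theorem diagPow_counitAt (n : ℕ) (i : Fin (n + 1)) :
    diagPow H (n + 1) ≫ counitAt H n i = diagPow H n := by
  have h0 {P : C} (d : H ⟶ P) : (Δ[H] ≫ H ◁ d) ≫ counitHead H P = d := by
    rw [Category.assoc, counitHead_naturality, counitHead, Category.assoc,
      ComonObj.counit_comul_assoc, Iso.inv_hom_id_assoc]
  induction n with
  | zero =>
    obtain rfl := Fin.fin_one_eq_zero i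
    exact h0 _
  | succ n ih =>
    cases i using Fin.cases with
    | zero => exact h0 _
    | succ i =>
      have key {P Q : C} (d : H ⟶ P) (f : P ⟶ Q) (g : H ⟶ Q) (h : d ≫ f = g) :
          (Δ[H] ≫ H ◁ d) ≫ H ◁ f = Δ[H] ≫ H ◁ g := by
        rw [← h, whiskerLeft_comp, Category.assoc]
      exact key _ _ _ (ih i)

/-- Splitting off the last factor instead of the first, by coassociativity; the rotation needs this
form. -/
theorem diagPow_snoc (n : ℕ) :
    (Δ[H] ≫ diagPow H n ▷ H) ≫ (powSnoc H n).hom = diagPow H (n + 1) := by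
  induction n with
  | zero =>
    change (Δ[H] ≫ ε[H] ▷ H) ≫ (λ_ H).hom ≫ (ρ_ H).inv = Δ[H] ≫ H ◁ ε[H]
    simp
  | succ n ih =>
    have key {P Q : C} (d : H ⟶ P) (s : P ⊗ H ⟶ Q) (g : H ⟶ Q) (h : (Δ[H] ≫ d ▷ H) ≫ s = g) :
        (Δ[H] ≫ (Δ[H] ≫ H ◁ d) ▷ H) ≫ (α_ H P H).hom ≫ H ◁ s = Δ[H] ≫ H ◁ g := by
      simp [← h]
    exact key _ _ _ ih

/-- The map `q` on `H^{⊗ (n+1)}` coequalizes the diagonal action and the character `δ`. -/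
def IsBalanced {H : C} [HopfObj H] (δ : H ⟶ 𝟙_ C) {n : ℕ} {B : C} (q : pow H (n + 1) ⟶ B) :
    Prop :=
  ActEq q (diagPow H (n + 1)) (δ ≫ η[pow H (n + 1)])

variable {H} {δ : H ⟶ 𝟙_ C} {σ : 𝟙_ C ⟶ H} {B : C}

/-- Such an `f` commutes with the diagonal action: `f(Δ(h) x) = Δ(h) f(x)`. -/
theorem IsBalanced.comp {m n : ℕ} (f : pow H (m + 1) ⟶ pow H (n + 1)) [IsMonHom f]
    (hf : diagPow H (m + 1) ≫ f = diagPow H (n + 1)) {q : pow H (n + 1) ⟶ B}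
    (hq : IsBalanced δ q) : IsBalanced δ (f ≫ q) := by
  refine ActEq.of_comp_hom ?_
  rw [hf, Category.assoc, IsMonHom.one_hom]
  exact hq

/-- `h ⊗ x ↦ S̃(h) x` on the tensor powers. -/
def powRetraction (δ : H ⟶ 𝟙_ C) (n : ℕ) : pow H (n + 1) ⟶ pow H n := retraction δ (diagPow H n)

theorem consUnit_powRetraction (hδ : IsCharacter δ) (n : ℕ) :
    consUnit H n ≫ powRetraction δ n = 𝟙 (pow H n) :=
  inrOne_retraction (diagPow H n) hδ

theorem isBalanced_powRetraction (hδ : IsCharacter δ) (n : ℕ) :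
    IsBalanced δ (powRetraction δ n) :=
  actEq_retraction (diagPow H n) hδ

theorem IsBalanced.powRetraction_comp {n : ℕ} {q : pow H (n + 1) ⟶ B} (hq : IsBalanced δ q) :
    powRetraction δ n ≫ consUnit H n ≫ q = q :=
  retraction_inrOne_comp (diagPow H n) hq

theorem powMap_lmul (hσ : IsCocharacter σ) (n : ℕ) :
    powMap (lmul σ) n = lmul (σ ≫ diagPow H n) := by
  induction n with
  | zero =>
    change 𝟙 (𝟙_ C) = lmul (σ ≫ ε[H])
    rw [hσ.counit]
    exact (lmul_one (Z := 𝟙_ C)).symm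
  | succ n ih =>
    have key {P : C} [MonObj P] (d : H ⟶ P) (f : P ⟶ P) (h : f = lmul (σ ≫ d)) :
        lmul σ ⊗ₘ f = lmul (σ ≫ Δ[H] ≫ H ◁ d) := by
      rw [reassoc_of% hσ.comul, h, ← lmul_tensor, ← id_tensorHom, tensorHom_comp_tensorHom,
        Category.comp_id]
    exact key _ _ ih

/-- As `σ` is group-like, multiplying every factor by `σ` is the diagonal action of `σ`, which a
balanced map turns into the scalar `δσ = 1`. -/
theorem IsBalanced.powMap_lmul_comp (hσ : IsCocharacter σ) (hσδ : σ ≫ δ = 𝟙 (𝟙_ C)) {n : ℕ}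
    {q : pow H (n + 1) ⟶ B} (hq : IsBalanced δ q) : powMap (lmul σ) (n + 1) ≫ q = q := by
  have h : (σ ≫ diagPow H (n + 1)) ▷ _ ≫ _ = _ ▷ _ ≫ _ := hq.precomp σ
  rw [reassoc_of% hσδ, MonObj.one_mul_assoc] at h
  rw [powMap_lmul hσ, lmul, Category.assoc, Category.assoc, h, Iso.inv_hom_id_assoc]

end Braided

section Symmetric

variable [SymmetricCategory C] {H : C} [HopfObj H] {δ : H ⟶ 𝟙_ C} {σ : 𝟙_ C ⟶ H} {B : C}

theorem IsBalanced.rot_comp (h : IsBraidedMPI δ σ) {n : ℕ} {q : pow H (n + 1) ⟶ B}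
    (hq : IsBalanced δ q) : IsBalanced δ (rot (lmul σ) n ≫ q) := by
  have h1 : ActEq ((powSnoc H n).hom ≫ q) (Δ[H] ≫ diagPow H n ▷ H) (δ ≫ η[pow H n ⊗ H]) := by
    refine ActEq.of_comp_hom ?_
    rw [diagPow_snoc, Category.assoc, IsMonHom.one_hom]
    exact hq
  have h2 := actEq_rotation h (diagPow H n) h1
  have e : rot (lmul σ) n ≫ q =
      lmul σ ▷ pow H n ≫ (β_ H (pow H n)).hom ≫ (powSnoc H n).hom ≫ q := by
    refine (Category.assoc _ _ _).trans (congrArg _ (Category.assoc _ _ _))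
  rw [e]
  exact h2

theorem IsBalanced.rotData_δ_comp (h : IsBraidedMPI δ σ) {n : ℕ} (i : Fin (n + 2))
    {q : pow H (n + 2) ⟶ B} (hq : IsBalanced δ q) :
    IsBalanced (n := n) δ ((rotData (lmul σ)).δ n i ≫ q) := by
  cases i using Fin.lastCases with
  | last =>
    rw [rotData_δ_last]
    have := (hq.rot_comp h).comp (comulAt H (n + 1) 0) (diagPow_comulAt H (n + 1) 0)
    rw [← Category.assoc] at this
    exact this
  | cast i =>
    rw [rotData_δ_castSucc]
    exact hq.comp (comulAt H (n + 1) i) (diagPow_comulAt H (n + 1) i)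

theorem IsBalanced.rotData_σ_comp {n : ℕ} (i : Fin (n + 1)) {q : pow H (n + 1) ⟶ B}
    (hq : IsBalanced δ q) : IsBalanced (n := n + 1) δ ((rotData (lmul σ)).σ n i ≫ q) :=
  hq.comp (counitAt H (n + 1) i.succ) (diagPow_counitAt H (n + 1) i.succ)

/-! ### The unit section -/

theorem inrOne_comulHead (H P : C) [HopfObj H] :
    inrOne H P ≫ comulHead H P = inrOne H P ≫ inrOne H (H ⊗ P) := by
  have h : η[H] ▷ P ≫ Δ[H] ▷ P = (λ_ (𝟙_ C)).inv ▷ P ≫ (η[H] ⊗ₘ η[H]) ▷ P := by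
    rw [← comp_whiskerRight, Bimon.one_comul, comp_whiskerRight]
  have h' : (λ_ (𝟙_ C)).inv ▷ P = (λ_ (𝟙_ C ⊗ P)).inv ≫ (α_ (𝟙_ C) (𝟙_ C) P).inv := by
    simp
  rw [inrOne, inrOne, comulHead, Category.assoc, Category.assoc, reassoc_of% h, h',
    ← tensorHom_id, ← tensorHom_id, associator_naturality, Category.assoc,
    Iso.inv_hom_id_assoc, MonoidalCategory.tensorHom_def', tensorHom_id, ← leftUnitor_inv_naturality_assoc]

theorem consUnit_rot (σ : 𝟙_ C ⟶ H) (n : ℕ) :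
    consUnit H n ≫ rot (lmul σ) n = snocMap σ n := by
  have key {P Q : C} (s : P ⊗ H ⟶ Q) :
      inrOne H P ≫ lmul σ ▷ P ≫ (β_ H P).hom ≫ s = (ρ_ P).inv ≫ P ◁ σ ≫ s := by
    rw [inrOne, Category.assoc, ← comp_whiskerRight_assoc, one_lmul,
      BraidedCategory.braiding_naturality_left_assoc, leftUnitor_inv_braiding_assoc]
  exact key _

theorem consUnit_rotData_δ (δ : H ⟶ 𝟙_ C) (σ : 𝟙_ C ⟶ H) (n : ℕ) (i : Fin (n + 2)) :
    consUnit H n ≫ (rotData (lmul σ)).δ n i = (cmData δ σ).δ n i ≫ consUnit H (n + 1) := by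
  cases i using Fin.cases with
  | zero =>
    rw [rotData_δ_zero]
    exact inrOne_comulHead H (pow H n)
  | succ i =>
    cases i using Fin.lastCases with
    | last =>
      have e : (cmData δ σ).δ n (Fin.last n).succ = snocMap σ n := by
        simp only [cmData, Fin.cases_succ, Fin.lastCases_last]
      rw [e, Fin.succ_last, rotData_δ_last]
      have h := inrOne_comulHead H (pow H n) =≫ rot (lmul σ) (n + 1)
      refine (Category.assoc _ _ _).symm.trans (h.trans ((Category.assoc _ _ _).trans ?_))
      refine (congrArg (inrOne H (pow H n) ≫ ·) (consUnit_rot σ (n + 1))).trans ?_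
      rw [snocMap_succ]
      exact inrOne_comp_whiskerLeft (snocMap σ n)
    | cast i =>
      have e : (cmData δ σ).δ n i.castSucc.succ = comulAt H n i := by
        simp only [cmData, Fin.cases_succ, Fin.lastCases_castSucc]
      rw [e, Fin.succ_castSucc, rotData_δ_castSucc]
      exact inrOne_comp_whiskerLeft (comulAt H n i)

theorem consUnit_rotData_σ (δ : H ⟶ 𝟙_ C) (σ : 𝟙_ C ⟶ H) (n : ℕ) (i : Fin (n + 1)) :
    consUnit H (n + 1) ≫ (rotData (lmul σ)).σ n i = (cmData δ σ).σ n i ≫ consUnit H n :=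
  inrOne_comp_whiskerLeft (counitAt H n i)

theorem twistedAntipode_counit (δ : H ⟶ 𝟙_ C) : twistedAntipode δ ≫ ε[H] = δ := by
  rw [twistedAntipode, Category.assoc, Category.assoc, ← leftUnitor_naturality,
    ← id_tensorHom, tensorHom_comp_tensorHom_assoc, HopfObj.antipode_counit,
    ComonObj.comul_counit_hom_assoc, unitors_equal, Iso.inv_hom_id, Category.comp_id, Category.comp_id]

/-- For `n ≥ 1` the retraction multiplies the remaining factors and `σ` by the iterated coproduct of
`S̃` of the first. For `n = 0` the first factor is `σ` itself, and `ε S̃ σ = δ σ = 1`. -/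
theorem snocMap_powRetraction (h : IsBraidedMPI δ σ) (n : ℕ) :
    snocMap σ n ≫ powRetraction δ n = cmTau δ σ n := by
  cases n with
  | zero =>
    change ((ρ_ (𝟙_ C)).inv ≫ 𝟙_ C ◁ σ ≫ (λ_ H).hom ≫ (ρ_ H).inv) ≫
      (twistedAntipode δ ≫ ε[H]) ▷ 𝟙_ C ≫ (λ_ (𝟙_ C)).hom = 𝟙 (𝟙_ C)
    rw [twistedAntipode_counit]
    simp [unitors_equal, h.modular]
  | succ n =>
    have key {P Q : C} [MonObj Q] (s : P ⟶ Q) (a : H ⟶ Q) :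
        H ◁ s ≫ a ▷ Q ≫ μ[Q] = (a ⊗ₘ s) ≫ μ[Q] := by
      rw [MonoidalCategory.tensorHom_def', Category.assoc]
    rw [snocMap_succ, cmTau, comulPow_eq_diagPow, mulPow_eq_mul]
    exact key _ _

end Symmetric

end Powers

/-! ### The module coalgebra and the SAYD module -/

section ModuleConditions

variable {C : Type u} [Category.{v} C] [MonoidalCategory C] [BraidedCategory C]

theorem isModuleCoalgebra_regular (H : C) [HopfObj H] : IsModuleCoalgebra (ModObj.regular H) where
  act_comul := BimonObj.mul_comul H
  act_counit := Bimon.mul_counit H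

/-- Over the unit object the condition reads `δ(h) σ = S(h₃) σ h₁ δ(h₂)`, which is `δ(h) σ = S̃(h₂)
σ h₁`; stability is `δσ = 1`. -/
theorem IsBraidedMPI.isSAYD {H : C} [HopfObj H] {δ : H ⟶ 𝟙_ C} {σ : 𝟙_ C ⟶ H}
    (h : IsBraidedMPI δ σ) :
    IsSAYD (characterModule h.character) (cocharacterComodule h.cocharacter) where
  ayd := by
    have e3 : (β_ (H ⊗ H) H).hom ≫ (𝒮[H] ⊗ₘ μ[H]) = (H ⊗ H) ◁ 𝒮[H] ≫ μ[H] ▷ H ≫ (β_ H H).hom := by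
      rw [← BraidedCategory.braiding_naturality, MonoidalCategory.tensorHom_def', Category.assoc]
    have e4 : lmul σ ▷ H = (λ_ (H ⊗ H)).inv ≫ σ ▷ (H ⊗ H) ≫ (α_ H H H).inv ≫ μ[H] ▷ H := by
      simp [lmul]
    have e5 : twistedAntipode δ = Δ[H] ≫ (β_ H H).hom ≫ H ◁ δ ≫ 𝒮[H] ▷ 𝟙_ C ≫ (ρ_ H).hom := by
      rw [twistedAntipode, ← MonoidalCategory.tensorHom_def'_assoc,
        ← BraidedCategory.braiding_naturality_assoc, braiding_rightUnitor]
    have e6 : Δ[H] ≫ (β_ H H).hom ≫ (twistedAntipode δ ⊗ₘ lmul σ) ≫ μ[H] =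
        (λ_ H).inv ≫ σ ▷ H ≫ H ◁ Δ[H] ≫ (α_ H H H).inv ≫
          (H ⊗ H) ◁ twistedAntipode δ ≫ μ[H] ▷ H ≫ (β_ H H).hom ≫ μ[H] := by
      rw [← BraidedCategory.braiding_naturality_assoc, MonoidalCategory.tensorHom_def,
        Category.assoc, e4, Category.assoc, Category.assoc, Category.assoc,
        leftUnitor_inv_naturality_assoc, whisker_exchange_assoc, whisker_exchange_assoc]
    have e7 {X Y Z : C} (f : X ⟶ Y) (g : Y ⟶ Z) : f ▷ H ≫ g ▷ H ≫ Z ◁ δ =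
        X ◁ δ ≫ f ▷ 𝟙_ C ≫ g ▷ 𝟙_ C := by
      rw [← whisker_exchange, ← whisker_exchange_assoc]
    -- Both sides are brought to this composite, free of trivial braidings with the unit object;
    -- what remains is coherence.
    refine Eq.trans (b := (λ_ H).hom ≫ ((λ_ H).inv ≫ σ ▷ H ≫ H ◁ Δ[H] ≫ H ◁ H ◁ Δ[H] ≫
        H ◁ H ◁ (β_ H H).hom) ⊗≫
        ((β_ (H ⊗ H) H).hom ≫ (𝒮[H] ⊗ₘ μ[H])) ▷ H ≫ μ[H] ▷ H ≫ H ◁ δ) ?_ ?_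
    · have e : (characterModule h.character).act ≫ (cocharacterComodule h.cocharacter).coact =
          (λ_ H).hom ≫ (δ ≫ σ) ≫ (ρ_ H).inv := by
        simp [cocharacterComodule, characterModule]
      rw [e, ← h.comul_braiding_twistedAntipode_lmul, e6, e5, e3, e7]
      monoidal
    · simp only [cocharacterComodule, characterModule, braiding_tensorUnit_left,
        MonoidalCategory.tensorHom_def]
      monoidal
  stable := by
    have e : (cocharacterComodule h.cocharacter).coact = σ ≫ (ρ_ H).inv := rfl
    have e' : (characterModule h.character).act = (λ_ H).hom ≫ δ := rfl
    rw [e, e', braiding_tensorUnit_right]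
    simp [h.modular]

end ModuleConditions

/-! ### The structure maps of the triple as twisted rotations -/

section Descent

variable {C : Type u} [Category.{v} C] [MonoidalCategory C] [SymmetricCategory C]
  {H : C} [HopfObj H] {δ : H ⟶ 𝟙_ C} {σ : 𝟙_ C ⟶ H}

theorem diagAct_regular (n : ℕ) :
    diagAct (ModObj.regular H) n = diagPow H (n + 1) ▷ pow H (n + 1) ≫ μ[pow H (n + 1)] := by
  rw [← mulPow_eq_mul, ← comulPow_eq_diagPow]
  rfl

theorem coact_rotate (hσ : IsCocharacter σ) (n : ℕ) :
    (cocharacterComodule hσ).coact ▷ pow H (n + 1) ≫ rotate (ModObj.regular H) (𝟙_ C) n =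
      𝟙_ C ◁ rot (lmul σ) n := by
  have key {P Q : C} (s : P ⊗ H ⟶ Q) :
      (σ ≫ (ρ_ H).inv) ▷ (H ⊗ P) ≫ (β_ H (𝟙_ C)).hom ▷ (H ⊗ P) ≫ (α_ (𝟙_ C) H (H ⊗ P)).hom ≫
        𝟙_ C ◁ ((α_ H H P).inv ≫ μ[H] ▷ P ≫ (β_ H P).hom ≫ s) =
      𝟙_ C ◁ (lmul σ ▷ P ≫ (β_ H P).hom ≫ s) := by
    rw [braiding_tensorUnit_right, lmul]
    monoidal
  exact key _

theorem tripleData_τ (hσ : IsCocharacter σ) (n : ℕ) :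
    (tripleData (ModObj.regular H) (cocharacterComodule hσ)).τ n =
      𝟙_ C ◁ (rotData (lmul σ)).τ n :=
  coact_rotate hσ n

theorem tripleData_σ (hσ : IsCocharacter σ) (n : ℕ) (i : Fin (n + 1)) :
    (tripleData (ModObj.regular H) (cocharacterComodule hσ)).σ n i =
      𝟙_ C ◁ (rotData (lmul σ)).σ n i :=
  rfl

theorem tripleData_δ (hσ : IsCocharacter σ) (n : ℕ) (i : Fin (n + 2)) :
    (tripleData (ModObj.regular H) (cocharacterComodule hσ)).δ n i =
      𝟙_ C ◁ (rotData (lmul σ)).δ n i := by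
  cases i using Fin.lastCases with
  | last =>
    have e : (tripleData (ModObj.regular H) (cocharacterComodule hσ)).δ n (Fin.last (n + 1)) =
        ((cocharacterComodule hσ).coact ⊗ₘ comulAt H (n + 1) 0) ≫
          rotate (ModObj.regular H) (𝟙_ C) (n + 1) := by
      simp only [tripleData, Fin.lastCases_last]
    rw [rotData_δ_last, e, MonoidalCategory.tensorHom_def', Category.assoc, coact_rotate hσ]
    exact (whiskerLeft_comp _ _ _).symm
  | cast i =>
    rw [rotData_δ_castSucc]
    simp only [tripleData, Fin.lastCases_castSucc]
    rfl

end Descent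

/-! ### Passage to the cokernels and comparison with `H^n` -/

section Abelian

variable {C : Type u} [Category.{v} C] [Abelian C] [MonoidalCategory C] [SymmetricCategory C]
  {H B : C} [HopfObj H] {δ : H ⟶ 𝟙_ C} {σ : 𝟙_ C ⟶ H}

/-- Turns the universal property of the cokernel into the relation `ActEq`, so that descent becomes
a computation in the algebras `H^{n+1}`. -/
theorem balancedMap_comp_eq_zero_iff (hδ : IsCharacter δ) {n : ℕ} (f : pow H (n + 1) ⟶ B) :
    balancedMap (ModObj.regular H) (characterModule hδ) n ≫ (λ_ (pow H (n + 1))).hom ≫ f = 0 ↔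
      IsBalanced δ f := by
  have e1 : (characterModule hδ).act ▷ pow H (n + 1) ≫ (λ_ (pow H (n + 1))).hom ≫ f =
      (λ_ H).hom ▷ pow H (n + 1) ≫ (δ ≫ η[pow H (n + 1)]) ▷ pow H (n + 1) ≫
        μ[pow H (n + 1)] ≫ f := by
    rw [comp_whiskerRight δ, Category.assoc, MonObj.one_mul_assoc, ← comp_whiskerRight_assoc]
    rfl
  have e2 : ((α_ (𝟙_ C) H (pow H (n + 1))).hom ≫ 𝟙_ C ◁ diagAct (ModObj.regular H) n) ≫
      (λ_ (pow H (n + 1))).hom ≫ f =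
      (λ_ H).hom ▷ pow H (n + 1) ≫ diagPow H (n + 1) ▷ pow H (n + 1) ≫
        μ[pow H (n + 1)] ≫ f := by
    rw [Category.assoc, leftUnitor_naturality_assoc, diagAct_regular, Category.assoc,
      leftUnitor_tensor_hom_assoc, Iso.hom_inv_id_assoc]
  rw [balancedMap, Preadditive.sub_comp, sub_eq_zero, e1, e2, cancel_epi, IsBalanced, ActEq]
  exact eq_comm

/-- The projection of `H^{⊗ (n+1)}` onto the balanced tensor product with the unit object. -/
def unitProj (hδ : IsCharacter δ) (n : ℕ) :
    pow H (n + 1) ⟶ balanced (ModObj.regular H) (characterModule hδ) n :=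
  (λ_ (pow H (n + 1))).inv ≫ balancedProj (ModObj.regular H) (characterModule hδ) n

instance epi_unitProj (hδ : IsCharacter δ) (n : ℕ) : Epi (unitProj hδ n) := by
  have : Epi (balancedProj (ModObj.regular H) (characterModule hδ) n) :=
    inferInstanceAs (Epi (cokernel.π _))
  exact epi_comp _ _

theorem leftUnitor_unitProj (hδ : IsCharacter δ) (n : ℕ) :
    (λ_ (pow H (n + 1))).hom ≫ unitProj hδ n =
      balancedProj (ModObj.regular H) (characterModule hδ) n :=
  Iso.hom_inv_id_assoc _ _

theorem isBalanced_unitProj (hδ : IsCharacter δ) (n : ℕ) : IsBalanced δ (unitProj hδ n) := by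
  rw [← balancedMap_comp_eq_zero_iff hδ, leftUnitor_unitProj]
  exact cokernel.condition _

/-- The map induced by a balanced map. -/
def IsBalanced.lift (hδ : IsCharacter δ) {n : ℕ} {f : pow H (n + 1) ⟶ B}
    (hf : IsBalanced δ f) : balanced (ModObj.regular H) (characterModule hδ) n ⟶ B :=
  cokernel.desc _ ((λ_ (pow H (n + 1))).hom ≫ f) ((balancedMap_comp_eq_zero_iff hδ f).2 hf)

theorem IsBalanced.balancedProj_lift (hδ : IsCharacter δ) {n : ℕ} {f : pow H (n + 1) ⟶ B}
    (hf : IsBalanced δ f) :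
    balancedProj (ModObj.regular H) (characterModule hδ) n ≫ hf.lift hδ =
      (λ_ (pow H (n + 1))).hom ≫ f :=
  cokernel.π_desc _ _ _

theorem IsBalanced.unitProj_lift (hδ : IsCharacter δ) {n : ℕ} {f : pow H (n + 1) ⟶ B}
    (hf : IsBalanced δ f) : unitProj hδ n ≫ hf.lift hδ = f := by
  rw [unitProj, Category.assoc, hf.balancedProj_lift hδ, Iso.inv_hom_id_assoc]

theorem balancedProj_lift_eq (hδ : IsCharacter δ) {m n : ℕ} (f : pow H (m + 1) ⟶ pow H (n + 1))
    (hf : IsBalanced δ (f ≫ unitProj hδ n)) :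
    balancedProj (ModObj.regular H) (characterModule hδ) m ≫ hf.lift hδ =
      𝟙_ C ◁ f ≫ balancedProj (ModObj.regular H) (characterModule hδ) n := by
  rw [hf.balancedProj_lift, ← leftUnitor_unitProj, leftUnitor_naturality_assoc]

variable (h : IsBraidedMPI δ σ)

/-- The structure maps on the balanced tensor products over a modular pair in involution. -/
def IsBraidedMPI.inducedMaps : InducedMaps (ModObj.regular H) (characterModule h.character)
    (cocharacterComodule h.cocharacter) where
  δ n i := ((isBalanced_unitProj h.character (n + 1)).rotData_δ_comp h i).lift h.character
  σ n i := ((isBalanced_unitProj h.character n).rotData_σ_comp (σ := σ) i).lift h.character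
  τ n := ((isBalanced_unitProj h.character n).rot_comp h).lift h.character
  proj_δ n i := by
    rw [tripleData_δ]
    exact balancedProj_lift_eq h.character (m := n) (n := n + 1) ((rotData (lmul σ)).δ n i)
      ((isBalanced_unitProj h.character (n + 1)).rotData_δ_comp h i)
  proj_σ n i := by
    rw [tripleData_σ]
    exact balancedProj_lift_eq h.character (m := n + 1) (n := n) ((rotData (lmul σ)).σ n i)
      ((isBalanced_unitProj h.character n).rotData_σ_comp i)
  proj_τ n := by
    rw [tripleData_τ]
    exact balancedProj_lift_eq h.character (rot (lmul σ) n)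
      ((isBalanced_unitProj h.character n).rot_comp h)

theorem IsBraidedMPI.unitProj_δ (n : ℕ) (i : Fin (n + 2)) :
    unitProj h.character n ≫ h.inducedMaps.δ n i =
      (rotData (lmul σ)).δ n i ≫ unitProj h.character (n + 1) :=
  IsBalanced.unitProj_lift h.character
    ((isBalanced_unitProj h.character (n + 1)).rotData_δ_comp h i)

theorem IsBraidedMPI.unitProj_σ (n : ℕ) (i : Fin (n + 1)) :
    unitProj h.character (n + 1) ≫ h.inducedMaps.σ n i =
      (rotData (lmul σ)).σ n i ≫ unitProj h.character n :=
  IsBalanced.unitProj_lift h.character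
    ((isBalanced_unitProj h.character n).rotData_σ_comp (σ := σ) i)

theorem IsBraidedMPI.unitProj_τ (n : ℕ) :
    unitProj h.character n ≫ h.inducedMaps.τ n = rot (lmul σ) n ≫ unitProj h.character n :=
  IsBalanced.unitProj_lift h.character
    ((isBalanced_unitProj h.character n).rot_comp h)

/-- The paracocyclic identities pass through the epimorphic projections; the `(n+1)`-st power of the
rotation is `L^{⊗(n+1)}`, which the projection absorbs. -/
theorem IsBraidedMPI.isCocyclic_inducedMaps : h.inducedMaps.toCocyclicData.IsCocyclic := by
  have hp := isParacocyclic_rotData (lmul_cocharacter_comul h.cocharacter)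
    (lmul_cocharacter_counit h.cocharacter)
  refine CocyclicData.IsParacocyclic.isCocyclic
    (@CocyclicData.IsParacocyclic.of_epi _ _ _ h.inducedMaps.toCocyclicData hp
      (fun n => unitProj h.character n) (epi_unitProj h.character)
      h.unitProj_δ h.unitProj_σ h.unitProj_τ) fun n => ?_
  have e := comp_end_pow (unitProj h.character n) (show End _ from rot (lmul σ) n)
    (show End _ from h.inducedMaps.τ n) (h.unitProj_τ n) (n + 1)
  rw [end_pow_eq_homPow (rot (lmul σ) n), homPow_rot,
    (isBalanced_unitProj h.character n).powMap_lmul_comp h.cocharacter h.modular] at e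
  refine (cancel_epi (unitProj h.character n)).1 ?_
  exact e.trans (Category.comp_id _).symm

/-- The balanced tensor product with the unit object is `H^{⊗ n}`. -/
def balancedIso (hδ : IsCharacter δ) (n : ℕ) :
    balanced (ModObj.regular H) (characterModule hδ) n ≅ pow H n where
  hom := (isBalanced_powRetraction hδ n).lift hδ
  inv := consUnit H n ≫ unitProj hδ n
  hom_inv_id := by
    rw [← cancel_epi (unitProj hδ n), ← Category.assoc, IsBalanced.unitProj_lift,
      (isBalanced_unitProj hδ n).powRetraction_comp, Category.comp_id]
  inv_hom_id := by
    rw [Category.assoc, IsBalanced.unitProj_lift, consUnit_powRetraction hδ]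

/-- The section does not commute with the rotation on `H^{n+1}`, since `1 ⊗ x ↦ x ⊗ σ`; inserting
the retraction, invisible in the quotient, restores the form `1 ⊗ τ x`. -/
theorem IsBraidedMPI.balancedIso_inv_τ (n : ℕ) :
    (balancedIso h.character n).inv ≫ h.inducedMaps.τ n =
      cmTau δ σ n ≫ (balancedIso h.character n).inv := by
  rw [balancedIso, ← snocMap_powRetraction h, Category.assoc, Category.assoc, h.unitProj_τ,
    (isBalanced_unitProj h.character n).powRetraction_comp, ← Category.assoc, consUnit_rot]

theorem comp_paste {D : Type u} [Category.{v} D] {X Y Z X' Y' Z' : D} {a : X ⟶ Y} {b : Y ⟶ Z}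
    {f : X ⟶ X'} {g : Y ⟶ Y'} {k : Z ⟶ Z'} {a' : X' ⟶ Y'} {b' : Y' ⟶ Z'}
    (h₁ : a ≫ g = f ≫ a') (h₂ : b ≫ k = g ≫ b') : (a ≫ b) ≫ k = f ≫ a' ≫ b' := by
  rw [Category.assoc, h₂, reassoc_of% h₁]

/-- Compatibility is checked on the inverse, which is given by the explicit section `x ↦ 1 ⊗ x`. -/
theorem comp_hom_of_inv_comp {D : Type u} [Category.{v} D] {X Y X' Y' : D} (e : X ≅ Y)
    (e' : X' ≅ Y') {f : X ⟶ X'} {g : Y ⟶ Y'} (h : e.inv ≫ f = g ≫ e'.inv) :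
    f ≫ e'.hom = e.hom ≫ g := by
  rw [← Iso.inv_comp_eq, reassoc_of% h, Iso.inv_hom_id, Category.comp_id]

/-- The cocyclic object on the balanced tensor products is the Connes–Moscovici one. -/
def IsBraidedMPI.inducedMapsIso : h.inducedMaps.toCocyclicData.Iso (cmData δ σ) where
  iso n := balancedIso h.character n
  comm_δ n i := comp_hom_of_inv_comp (balancedIso h.character n) (balancedIso h.character (n + 1))
    (comp_paste (consUnit_rotData_δ δ σ n i) (h.unitProj_δ n i))
  comm_σ n i := comp_hom_of_inv_comp (balancedIso h.character (n + 1)) (balancedIso h.character n)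
    (comp_paste (consUnit_rotData_σ δ σ n i) (h.unitProj_σ n i))
  comm_τ n := comp_hom_of_inv_comp _ _ (h.balancedIso_inv_τ n)

end Abelian

end

end BraidedHopfCyclic

theorem mainTheorem3 {C : Type u} [Category.{v} C] [Abelian C] [MonoidalCategory C]
    [SymmetricCategory C] (H : C) [HopfObj H] (δ : H ⟶ 𝟙_ C) (σ : 𝟙_ C ⟶ H)
    (h : BraidedHopfCyclic.IsBraidedMPI δ σ) :
    BraidedHopfCyclic.IsModuleCoalgebra (ModObj.regular H) ∧
    BraidedHopfCyclic.IsSAYD (BraidedHopfCyclic.characterModule h.character)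
      (BraidedHopfCyclic.cocharacterComodule h.cocharacter) ∧
    (BraidedHopfCyclic.cmData δ σ).IsCocyclic ∧
    ∃ T : BraidedHopfCyclic.InducedMaps (ModObj.regular H)
        (BraidedHopfCyclic.characterModule h.character)
        (BraidedHopfCyclic.cocharacterComodule h.cocharacter),
      T.toCocyclicData.IsCocyclic ∧
      Nonempty (T.toCocyclicData.Iso (BraidedHopfCyclic.cmData δ σ)) :=
  ⟨BraidedHopfCyclic.isModuleCoalgebra_regular H, h.isSAYD,
    h.inducedMapsIso.isCocyclic h.isCocyclic_inducedMaps, h.inducedMaps,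
    h.isCocyclic_inducedMaps, ⟨h.inducedMapsIso⟩⟩
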